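/- Theorem 2 ($W_{1+\infty}$ constraints). Let $p\ge 1$, $q\ge 0$ be integers, $g\in\mathbb C\setminus\{0\}$, $\gamma=-(p-1)/2$, and let $b=(b_1,\dots,b_{p+q})\in\mathbb C^{p+q}$ be a background for the variables $x=(x_1,\dots,x_{p+q})$. Consider pseudo-differential operators in $\partial=g\,\partial/\partial x_1$ whose coefficients are formal power series in the $x_n-b_n$; $A_+$ and $A_-$ denote the parts of $A$ with non-negative and with negative powers of $\partial$ (coefficients written on the left). Let $\boldsymbol W=1+\sum_{n\ge1}w_n(x)\partial^{-n}$ be a Sato operator which solves the Douglas equation with its deformations, i.e., with $\boldsymbol L=\boldsymbol W\partial\boldsymbol W^{-1}$, $$g\,\frac{\partial \boldsymbol W}{\partial x_n}=(\boldsymbol L^n)_+\boldsymbol W-\boldsymbol W\partial^n\quad(1\le n\le p+q),$$ $$\bigl(\boldsymbol W\partial^p\boldsymbol W^{-1}\bigr)_-=0,\qquad \Bigl(\boldsymbol W\bigl(\textstyle\sum_{n=1}^{p+q}n x_n\partial^{n-p}+g\gamma\,\partial^{-p}\bigr)\boldsymbol W^{-1}\Bigr)_-=0 .$$ Let $\psi(\lambda)=\sum_{r\in\mathbb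 Z+1/2}\psi_r\lambda^{-r-1/2}$ and $\bar\psi(\lambda)=\sum_{r\in\mathbb Z+1/2}\bar\psi_r\lambda^{-r-1/2}$ be free fermions, $\{\psi_r,\bar\psi_s\}=\delta_{r+s,0}$ (all other anticommutators vanish), acting on the completed Fock space of arbitrary linear combinations of the states $\bar\psi_{r_0}\bar\psi_{r_1}\cdots|\Omega\rangle$, $r_0<r_1<\cdots$, where $\psi_r|\Omega\rangle=0$ for all $r$ and $\{r_0,r_1,\dots\}$ differs from $\{\tfrac12,\tfrac32,\dots\}$ by finitely many elements. Let $|0\rangle=\prod_{k\ge0}\bar\psi_{k+1/2}|\Omega\rangle$ and let $\alpha_n$ be the coefficient of $\lambda^{-n-1}$ in $\psi(\lambda)\bar\psi(\lambda)$, normal ordered with respect to $|0\rangle$. Put $\Phi_k(b;\lambda)=[\partial^k\boldsymbol W(x;\partial)]|_{x=b,\ \partial\to\lambda}=\lambda^k+(\text{lower powers})$; these functions span the point $\mathcal V(b)$ of the Grassmannian corresponding to $\boldsymbol W$ at $x=b$, with fermion state $$|\Phi(b)\rangle=\prod_{k\ge0}\Bigl[\oint\frac{d\lambda}{2\pi i}\,\bar\psi(\lambda)\,\Phi_k(b;\lambda)\Bigr]|\Omega\rangle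 .$$ The state of the initial point $\mathcal V=\mathcal V(0)=e^{(1/g)\sum_n b_n\lambda^n}\mathcal V(b)$ is the formal vector $|\Phi\rangle=e^{-A}|\Phi(b)\rangle$, $A=\frac1g\sum_{n=1}^{p+q}b_n\alpha_n$. An operator $O$ for which $e^{A}Oe^{-A}=\sum_{j\ge0}\frac1{j!}(\mathrm{ad}\,A)^jO$ is a terminating series acts on it by $O|\Phi\rangle=e^{-A}\,(e^{A}Oe^{-A})\,|\Phi(b)\rangle$. For $s\ge1$ and $n\in\mathbb Z$ let $$W^s_n=\sum_{a=0}^{p-1}\oint\frac{d\zeta}{2\pi i}\,s\,\zeta^{n+s-1}:\!\partial_\zeta^{s-1}c_a(\zeta)\cdot\bar c_a(\zeta)\!:,$$ where $\zeta=\lambda^p$, $c_0(\zeta)=(d\lambda/d\zeta)^{1/2}\psi(\lambda)$, $\bar c_0(\zeta)=(d\lambda/d\zeta)^{1/2}\bar\psi(\lambda)$, $c_a(\zeta)=c_0(e^{2\pi i a}\zeta)$, $\bar c_a(\zeta)=\bar c_0(e^{2\pi i a}\zeta)$, and $:\ :$ is the canonical normal ordering on the $\zeta$-plane (subtraction of $1/(\zeta_1-\zeta_2)$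 from $c_a(\zeta_1)\bar c_a(\zeta_2)$). Then, for all $s\ge1$ and $n\ge -s+1$, the series for $e^{A}W^s_ne^{-A}$ terminates and $$W^s_n\,|\Phi\rangle=0 .$$ -/

import Mathlib

open Filter

noncomputable section

/-! ### Pseudo-differential operators -/

/-- A formal pseudo-differential operator `∑_{n ≤ N} a_n ∂^n` with coefficients `a_n` in `R`,
written with the coefficients on the left. -/
@[ext]
structure PDO (R : Type) [CommRing R] where
  /-- `coeff n` is the coefficient `a_n` of `∂^n`. -/
  coeff : ℤ → R
  /-- The order is bounded above. -/
  bdd : ∃ N : ℤ, ∀ n : ℤ, N < n → coeff n = 0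

namespace PDO

variable {R : Type} [CommRing R] [Algebra ℂ R]

/-- The operator `∂^n`, `n ∈ ℤ`. -/
def dpow (R : Type) [CommRing R] (n : ℤ) : PDO R where
  coeff m := if m = n then 1 else 0
  bdd := ⟨n, fun _ hm => if_neg hm.ne'⟩

/-- The unit operator. -/
def one (R : Type) [CommRing R] : PDO R := dpow R 0

/-- The coefficient of `∂^m` in a product: because of
`∂^i · f = ∑_{k ≥ 0} binom(i, k) (δ^k f) ∂^{i-k}`, the term `a_i ∂^i · b_j ∂^j` contributes
`binom(i, k) a_i (δ^k b_j)` to the coefficient of `∂^{i+j-k}`.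
Only finitely many pairs `(i, k)` contribute. -/
def mulCoeff (δ : Derivation ℂ R R) (A B : PDO R) (m : ℤ) : R :=
  ∑ᶠ ik : ℤ × ℕ, Ring.choose ik.1 ik.2 •
    (A.coeff ik.1 * (δ^[ik.2]) (B.coeff (m - ik.1 + ik.2)))

/-- The product of pseudo-differential operators, where `∂` acts on the coefficients as the
derivation `δ`. -/
def mul (δ : Derivation ℂ R R) (A B : PDO R) : PDO R where
  coeff := mulCoeff δ A B
  bdd := by
    obtain ⟨N, hN⟩ := A.bdd
    obtain ⟨M, hM⟩ := B.bdd
    refine ⟨N + M, fun m hm => ?_⟩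
    have hz : ∀ k : ℕ, (δ^[k]) (0 : R) = 0 := fun k => by
      induction k with
      | zero => rfl
      | succ k ih => rw [Function.iterate_succ_apply', ih, map_zero]
    rw [mulCoeff, finsum_eq_zero_of_forall_eq_zero]
    rintro ⟨i, k⟩
    by_cases hi : N < i
    · simp [hN i hi]
    · have : B.coeff (m - i + k) = 0 := hM _ (by omega)
      simp [this, hz]

/-- Powers `A^n`, `n ≥ 0`. -/
def npow (δ : Derivation ℂ R R) (A : PDO R) : ℕ → PDO R
  | 0 => one R
  | n + 1 => mul δ A (npow δ A n)

/-- The differential operator part `A_+ = ∑_{n ≥ 0} a_n ∂^n`. -/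
def pos (A : PDO R) : PDO R where
  coeff n := if 0 ≤ n then A.coeff n else 0
  bdd := by
    obtain ⟨N, hN⟩ := A.bdd
    refine ⟨N, fun n hn => ?_⟩
    simp [hN n hn]

/-- `A_- = 0`, that is, `A` is a differential operator. -/
def IsDifferential (A : PDO R) : Prop := ∀ n : ℤ, n < 0 → A.coeff n = 0

end PDO

/-! ### The Sato operator and the Douglas equation

The flow variables are `x_1, …, x_N`; the coefficients of all operators are formal power series
in `x_n - b_n` around a background point `b`.  The variable with index `i : Fin N` is `x_{i+1}`,
and as a power series it is `x_{i+1} = b_{i+1} + X_i`. -/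

/-- Functions of `x = (x_1, …, x_N)` near the background: formal power series in the
deviations `x_n - b_n`. -/
abbrev Fun (N : ℕ) : Type := MvPowerSeries (Fin N) ℂ

/-- The value at the background point `x = b`. -/
def atBackground {N : ℕ} (f : Fun N) : ℂ := MvPowerSeries.constantCoeff f

/-- The coordinate function `x_{i+1}`. -/
def xVar {N : ℕ} (b : Fin N → ℂ) (i : Fin N) : Fun N :=
  MvPowerSeries.C (b i) + MvPowerSeries.X i

/-- The partial derivative `∂/∂x_{i+1}`. -/
def partialX {N : ℕ} (i : Fin N) : Derivation ℂ (Fun N) (Fun N) := MvPowerSeries.pderiv ℂ i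

/-- The derivation `g ∂/∂x_1` by which `∂` acts on functions. -/
def delta {N : ℕ} (hN : 0 < N) (g : ℂ) : Derivation ℂ (Fun N) (Fun N) :=
  g • partialX ⟨0, hN⟩

/-- The operator `∑_{n=1}^{N} n x_n ∂^{n-p} + g γ ∂^{-p}`. -/
def stringOp {N : ℕ} (p : ℕ) (g γ : ℂ) (b : Fin N → ℂ) : PDO (Fun N) where
  coeff m := (∑ i : Fin N, if m = (i : ℤ) + 1 - p then ((i : ℂ) + 1) • xVar b i else 0)
    + if m = -(p : ℤ) then MvPowerSeries.C (g * γ) else 0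
  bdd := by
    refine ⟨N, fun m hm => ?_⟩
    rw [Finset.sum_eq_zero, if_neg (by omega), add_zero]
    intro i _
    have := i.2
    rw [if_neg (by omega)]

/-- `W = ∑_{n ≥ 0} w_n(x) ∂^{-n}` with `w_0 = 1`. -/
def IsSatoOperator {N : ℕ} (W : PDO (Fun N)) : Prop :=
  W.coeff 0 = 1 ∧ ∀ n : ℤ, 0 < n → W.coeff n = 0

/-- The Sato operator `W`, with two-sided inverse `Winv`, solves the Douglas equation together
with its deformations.  Put `L = W ∂ W⁻¹`, `P = W ∂^p W⁻¹` and
`Q = (1/p) W (∑ n x_n ∂^{n-p} + g γ ∂^{-p}) W⁻¹`.  Then `W` satisfies the Sato equation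
`g ∂W/∂x_n = (L^n)_+ W - W ∂^n` in every flow variable, and both `P` and `Q` are differential
operators. -/
structure SolvesDouglas {N : ℕ} (hN : 0 < N) (p : ℕ) (g γ : ℂ) (b : Fin N → ℂ)
    (W Winv : PDO (Fun N)) : Prop where
  /-- `W` is a Sato operator. -/
  sato_form : IsSatoOperator W
  /-- `W W⁻¹ = 1`. -/
  mul_inv : PDO.mul (delta hN g) W Winv = PDO.one (Fun N)
  /-- `W⁻¹ W = 1`. -/
  inv_mul : PDO.mul (delta hN g) Winv W = PDO.one (Fun N)
  /-- The Sato equation in the variable `x_{i+1}`. -/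
  sato_eq : ∀ (i : Fin N) (m : ℤ),
    g • partialX i (W.coeff m) =
      (PDO.mul (delta hN g)
        (PDO.pos (PDO.npow (delta hN g)
          (PDO.mul (delta hN g) (PDO.mul (delta hN g) W (PDO.dpow (Fun N) 1)) Winv)
          ((i : ℕ) + 1))) W).coeff m
      - (PDO.mul (delta hN g) W (PDO.dpow (Fun N) ((i : ℤ) + 1))).coeff m
  /-- `(W ∂^p W⁻¹)_- = 0`. -/
  P_differential :
    (PDO.mul (delta hN g) (PDO.mul (delta hN g) W (PDO.dpow (Fun N) (p : ℤ))) Winv).IsDifferential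
  /-- `(W (∑ n x_n ∂^{n-p} + g γ ∂^{-p}) W⁻¹)_- = 0`. -/
  Q_differential :
    (PDO.mul (delta hN g) (PDO.mul (delta hN g) W (stringOp p g γ b)) Winv).IsDifferential

/-- The function `Φ_k(b; λ) = [∂^k W(b; ∂)]_{∂ → λ}`, a Laurent series in `λ⁻¹`, as the family of
its coefficients: `satoFrame hN g W k m` is the coefficient of `λ^m`. These functions span the
point `𝒱(b)` of the Grassmannian. -/
def satoFrame {N : ℕ} (hN : 0 < N) (g : ℂ) (W : PDO (Fun N)) (k : ℕ) (m : ℤ) : ℂ :=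
  atBackground ((PDO.mul (delta hN g) (PDO.dpow (Fun N) (k : ℤ)) W).coeff m)

/-- `Φ_k(b; λ) = λ^k + (lower powers)`. -/
theorem satoFrame_leading {N : ℕ} (hN : 0 < N) (g : ℂ) {W : PDO (Fun N)}
    (hW : IsSatoOperator W) (k : ℕ) :
    satoFrame hN g W k k = 1 ∧ ∀ m : ℤ, (k : ℤ) < m → satoFrame hN g W k m = 0 := by
  have hone : ∀ j : ℕ, ((delta hN g)^[j + 1]) (1 : Fun N) = 0 := by
    intro j
    induction j with
    | zero => simp
    | succ j ih => rw [Function.iterate_succ_apply', ih, map_zero]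
  have hzero : ∀ j : ℕ, ((delta hN g)^[j]) (0 : Fun N) = 0 := by
    intro j
    induction j with
    | zero => rfl
    | succ j ih => rw [Function.iterate_succ_apply', ih, map_zero]
  have hvan : ∀ (m : ℤ), (k : ℤ) ≤ m → ∀ ij : ℤ × ℕ, (ij ≠ ((k : ℤ), 0) ∨ (k : ℤ) < m) →
      Ring.choose ij.1 ij.2 • ((PDO.dpow (Fun N) (k : ℤ)).coeff ij.1 *
        ((delta hN g)^[ij.2]) (W.coeff (m - ij.1 + ij.2))) = 0 := by
    rintro m hm ⟨i, j⟩ h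
    by_cases hi : i = k
    · subst hi
      rcases Nat.eq_zero_or_pos j with rfl | hj
      · have hm' : (k : ℤ) < m := h.resolve_left (fun h => h rfl)
        simp [hW.2 (m - k) (by omega)]
      · simp [hW.2 (m - k + j) (by omega), hzero]
    · simp [PDO.dpow, hi]
  constructor
  · show atBackground (PDO.mulCoeff _ _ _ _) = 1
    rw [PDO.mulCoeff, finsum_eq_single _ ((k : ℤ), 0) (fun ij h => hvan k le_rfl ij (Or.inl h))]
    simp [PDO.dpow, hW.1, atBackground]
  · intro m hm
    show atBackground (PDO.mulCoeff _ _ _ _) = 0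
    rw [PDO.mulCoeff, finsum_eq_zero_of_forall_eq_zero (fun ij => hvan m hm.le ij (Or.inr hm))]
    simp [atBackground]

/-! ### The fermion Fock space -/

/-- A Maya diagram: a set of integers that differs from `{0, 1, 2, …}` by finitely many elements.
The set `{s_0 < s_1 < …}` stands for the state `ψ̄_{s_0+1/2} ψ̄_{s_1+1/2} ⋯ |Ω⟩`. -/
@[ext]
structure Maya where
  /-- The occupied sites. -/
  carrier : Set ℤ
  finite_neg : {k : ℤ | k ∈ carrier ∧ k < 0}.Finite
  finite_hole : {k : ℤ | k ∉ carrier ∧ 0 ≤ k}.Finite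

namespace Maya

/-- Fill the site `k`. -/
def fill (S : Maya) (k : ℤ) : Maya where
  carrier := insert k S.carrier
  finite_neg := (S.finite_neg.insert k).subset (by
    rintro j ⟨h | h, hj⟩
    · exact Or.inl h
    · exact Or.inr ⟨h, hj⟩)
  finite_hole := S.finite_hole.subset (fun _ hj => ⟨fun h => hj.1 (Or.inr h), hj.2⟩)

/-- Empty the site `k`. -/
def empty (S : Maya) (k : ℤ) : Maya where
  carrier := S.carrier \ {k}
  finite_neg := S.finite_neg.subset (fun _ hj => ⟨hj.1.1, hj.2⟩)
  finite_hole := (S.finite_hole.insert k).subset (by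
    rintro j ⟨h, hj⟩
    by_cases hk : j = k
    · exact Or.inl hk
    · exact Or.inr ⟨fun hS => h ⟨hS, hk⟩, hj⟩)

/-- The diagram `{N, N+1, …}`. -/
def above (N : ℕ) : Maya where
  carrier := {k : ℤ | (N : ℤ) ≤ k}
  finite_neg := Set.finite_empty.subset (fun k hk => by
    have h1 : (N : ℤ) ≤ k := hk.1
    have h2 := hk.2
    omega)
  finite_hole := (Set.finite_Ico (0 : ℤ) N).subset (fun k hk => by
    have h1 : ¬ (N : ℤ) ≤ k := hk.1
    exact ⟨hk.2, by omega⟩)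

/-- The sign `(-1)^{#{j ∈ S : j < k}}`. -/
def sign (S : Maya) (k : ℤ) : ℂ := (-1) ^ {j : ℤ | j ∈ S.carrier ∧ j < k}.ncard

end Maya

/-- The (completed) fermion Fock space: arbitrary, possibly infinite, linear combinations of the
basis states indexed by Maya diagrams. -/
abbrev Fock : Type := Maya → ℂ

open Classical in
/-- The mode `ψ̄_{k+1/2}`: it fills the site `k`. It is the mode of `λ^{-k-1}` in
`ψ̄(λ) = ∑ ψ̄_r λ^{-r-1/2}`. -/
def psiBarMode (k : ℤ) : Module.End ℂ Fock where
  toFun v S := if k ∈ S.carrier then S.sign k * v (S.empty k) else 0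
  map_add' u v := by
    funext S
    by_cases h : k ∈ S.carrier <;> simp [h, mul_add]
  map_smul' c v := by
    funext S
    by_cases h : k ∈ S.carrier <;> simp [h, mul_left_comm]

open Classical in
/-- The mode `ψ_{-k-1/2}`: it empties the site `k`. It is the mode of `λ^k` in
`ψ(λ) = ∑ ψ_r λ^{-r-1/2}`. -/
def psiMode (k : ℤ) : Module.End ℂ Fock where
  toFun v S := if k ∈ S.carrier then 0 else S.sign k * v (S.fill k)
  map_add' u v := by
    funext S
    by_cases h : k ∈ S.carrier <;> simp [h, mul_add]
  map_smul' c v := by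
    funext S
    by_cases h : k ∈ S.carrier <;> simp [h, mul_left_comm]

open Classical in
/-- The basis state of a Maya diagram. -/
def basisState (T : Maya) : Fock := fun S => if S = T then 1 else 0

/-- `ψ_{-k-1/2} ψ̄_{j+1/2}`, normal ordered with respect to the Dirac vacuum
`|0⟩ = ∏_{k ≥ 0} ψ̄_{k+1/2} |Ω⟩`, i.e. minus its vacuum expectation value. -/
def normalOrdered (k j : ℤ) : Module.End ℂ Fock :=
  psiMode k * psiBarMode j - (if k = j ∧ k < 0 then (1 : ℂ) else 0) • 1

theorem psi_apply_of_mem {k : ℤ} {S : Maya} (h : k ∈ S.carrier) (v : Fock) :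
    psiMode k v S = 0 := if_pos h

theorem psi_apply_of_notMem {k : ℤ} {S : Maya} (h : k ∉ S.carrier) (v : Fock) :
    psiMode k v S = S.sign k * v (S.fill k) := if_neg h

theorem psiBar_apply_of_mem {k : ℤ} {S : Maya} (h : k ∈ S.carrier) (v : Fock) :
    psiBarMode k v S = S.sign k * v (S.empty k) := if_pos h

theorem psiBar_apply_of_notMem {k : ℤ} {S : Maya} (h : k ∉ S.carrier) (v : Fock) :
    psiBarMode k v S = 0 := if_neg h

theorem normalOrdered_apply (k j : ℤ) (v : Fock) (S : Maya) :
    normalOrdered k j v S =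
      psiMode k (psiBarMode j v) S - (if k = j ∧ k < 0 then (1 : ℂ) else 0) * v S := rfl

theorem Maya.sign_mul_self (S : Maya) (k : ℤ) : S.sign k * S.sign k = 1 := by
  rw [Maya.sign, ← mul_pow]
  norm_num

theorem Maya.empty_fill {S : Maya} {k : ℤ} (h : k ∉ S.carrier) : (S.fill k).empty k = S := by
  ext j
  constructor
  · rintro ⟨h1 | h1, h2⟩
    · exact absurd h1 h2
    · exact h1
  · intro hj
    exact ⟨Or.inr hj, fun h' => h (h' ▸ hj)⟩

theorem Maya.sign_fill_self (S : Maya) (k : ℤ) : (S.fill k).sign k = S.sign k := by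
  have : {j : ℤ | j ∈ (S.fill k).carrier ∧ j < k} = {j : ℤ | j ∈ S.carrier ∧ j < k} := by
    ext j
    constructor
    · rintro ⟨h1 | h1, h2⟩
      · exact absurd h1 h2.ne
      · exact ⟨h1, h2⟩
    · rintro ⟨h1, h2⟩
      exact ⟨Or.inr h1, h2⟩
  rw [Maya.sign, Maya.sign, this]

/-- In an infinite sum of bilinears of a fixed degree only finitely many terms contribute to each
coefficient. -/
theorem bilinear_finite (c : ℤ → ℂ) (m : ℤ) (v : Fock) (S : Maya) :
    (Function.support fun k : ℤ => c k * normalOrdered k (k + m) v S).Finite := by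
  have hneg : {k : ℤ | k + m ∈ S.carrier ∧ k + m < 0}.Finite :=
    (S.finite_neg.image (fun k => k - m)).subset (fun k hk => ⟨k + m, hk, by simp⟩)
  refine ((((S.finite_hole.union hneg).union S.finite_neg).union
    (Set.finite_Icc (-|m|) |m|))).subset (fun k hk => ?_)
  by_contra hcon
  simp only [Set.mem_union, Set.mem_ofPred_eq, not_or, Set.mem_Icc] at hcon
  obtain ⟨⟨⟨h1, h2⟩, h3⟩, h4⟩ := hcon
  have hm1 := neg_abs_le m
  have hm2 := le_abs_self m
  apply hk
  show c k * normalOrdered k (k + m) v S = 0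
  rw [normalOrdered_apply]
  by_cases hS : k ∈ S.carrier
  · have hk0 : ¬ k < 0 := fun h => h3 ⟨hS, h⟩
    rw [psi_apply_of_mem hS, if_neg (fun h => hk0 h.2)]
    ring
  · have hk0 : k < 0 := by
      by_contra h
      exact h1 ⟨hS, by omega⟩
    rw [psi_apply_of_notMem hS]
    by_cases hm : m = 0
    · subst hm
      rw [add_zero, psiBar_apply_of_mem (Or.inl rfl), if_pos ⟨rfl, hk0⟩,
        Maya.empty_fill hS, Maya.sign_fill_self, ← mul_assoc, Maya.sign_mul_self]
      ring
    · have hkm : k + m ∉ S.carrier := by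
        intro h
        apply h2
        refine ⟨h, ?_⟩
        by_contra h'
        apply h4
        constructor <;> omega
      rw [psiBar_apply_of_notMem (by
        rintro (h | h)
        · omega
        · exact hkm h), if_neg (by omega)]
      ring

/-- The operator `∑_{k ∈ ℤ} c_k ∘ψ_{-k-1/2} ψ̄_{k+m+1/2}∘`. -/
def bilinear (c : ℤ → ℂ) (m : ℤ) : Module.End ℂ Fock where
  toFun v S := ∑ᶠ k : ℤ, c k * normalOrdered k (k + m) v S
  map_add' u v := by
    funext S
    show _ = (∑ᶠ k : ℤ, c k * normalOrdered k (k + m) u S) +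
      ∑ᶠ k : ℤ, c k * normalOrdered k (k + m) v S
    exact (finsum_congr fun k => by rw [map_add, Pi.add_apply, mul_add]).trans
      (finsum_add_distrib (bilinear_finite c m u S) (bilinear_finite c m v S))
  map_smul' a v := by
    funext S
    show _ = a * ∑ᶠ k : ℤ, c k * normalOrdered k (k + m) v S
    refine Eq.trans (finsum_congr fun k => ?_) (mul_finsum' _ a (bilinear_finite c m v S)).symm
    rw [map_smul, Pi.smul_apply, smul_eq_mul, mul_left_comm]

/-- The current modes `α_n`: `∘ψ(λ)ψ̄(λ)∘ = ∑ α_n λ^{-n-1}`. -/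
def alpha (n : ℤ) : Module.End ℂ Fock := bilinear (fun _ => 1) n

/-! ### The fermion state of a point of the Grassmannian -/

/-- `∮ dλ/(2πi) ψ̄(λ) f(λ) = ∑_m f_m ψ̄_{m+1/2}` for a Laurent series `f = ∑_m f_m λ^m` in `λ⁻¹`. -/
def psiBarSmeared (f : ℤ → ℂ) (v : Fock) : Fock := fun S => ∑ᶠ m : ℤ, f m * psiBarMode m v S

/-- `wedgeApply Φ N v = ψ̄(Φ_0) ψ̄(Φ_1) ⋯ ψ̄(Φ_{N-1}) v`. -/
def wedgeApply (Φ : ℕ → ℤ → ℂ) : ℕ → Fock → Fock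
  | 0, v => v
  | N + 1, v => wedgeApply Φ N (psiBarSmeared (Φ N) v)

/-- The decomposable state `∏_{k ≥ 0} [∮ dλ/(2πi) ψ̄(λ) Φ_k(λ)] |Ω⟩` for a frame with
`Φ_k = λ^k + (lower powers)`.  Each coefficient is the limit, as `N → ∞`, of its value for
`∏_{k < N} [∮ ψ̄ Φ_k] ∏_{k ≥ N} ψ̄_{k+1/2} |Ω⟩`, which is eventually constant. -/
def decomposableState (Φ : ℕ → ℤ → ℂ) : Fock := fun S =>
  limUnder atTop (fun N : ℕ => wedgeApply Φ N (basisState (Maya.above N)) S)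

theorem psiBarSmeared_finite {f : ℤ → ℂ} {d : ℤ} (hf : ∀ m, d < m → f m = 0) (v : Fock)
    (S : Maya) : (Function.support fun m : ℤ => f m * psiBarMode m v S).Finite := by
  refine (S.finite_neg.union (Set.finite_Icc 0 d)).subset (fun m hm => ?_)
  by_contra hcon
  apply hm
  show f m * psiBarMode m v S = 0
  by_cases hS : m ∈ S.carrier
  · rw [hf m, zero_mul]
    by_contra hd
    apply hcon
    by_cases h0 : m < 0
    · exact Or.inl ⟨hS, h0⟩
    · exact Or.inr ⟨by omega, by omega⟩
  · rw [psiBar_apply_of_notMem hS, mul_zero]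

theorem psiBarSmeared_add {f : ℤ → ℂ} {d : ℤ} (hf : ∀ m, d < m → f m = 0) (u v : Fock) :
    psiBarSmeared f (u + v) = psiBarSmeared f u + psiBarSmeared f v := by
  funext S
  exact (finsum_congr fun m => by rw [map_add, Pi.add_apply, mul_add]).trans
    (finsum_add_distrib (psiBarSmeared_finite hf u S) (psiBarSmeared_finite hf v S))

theorem wedgeApply_add {Φ : ℕ → ℤ → ℂ} (hΦ : ∀ (k : ℕ) (m : ℤ), (k : ℤ) < m → Φ k m = 0) (N : ℕ) :
    ∀ u v : Fock, wedgeApply Φ N (u + v) = wedgeApply Φ N u + wedgeApply Φ N v := by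
  induction N with
  | zero => intro u v; rfl
  | succ N ih =>
    intro u v
    show wedgeApply Φ N _ = _
    rw [psiBarSmeared_add (hΦ N), ih]
    rfl

theorem wedgeApply_eq_zero {Φ : ℕ → ℤ → ℂ} (hΦ : ∀ (k : ℕ) (m : ℤ), (k : ℤ) < m → Φ k m = 0) {M : ℕ}
    (N : ℕ) (hN : N ≤ M) :
    ∀ v : Fock, (∀ S : Maya, (M : ℤ) ∈ S.carrier → v S = 0) →
      ∀ S : Maya, (M : ℤ) ∈ S.carrier → wedgeApply Φ N v S = 0 := by
  induction N with
  | zero => intro v hv; exact hv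
  | succ N ih =>
    intro v hv
    apply ih (by omega)
    intro S hS
    apply finsum_eq_zero_of_forall_eq_zero
    intro m
    by_cases hm : m ∈ S.carrier
    · by_cases hmN : (N : ℤ) < m
      · rw [hΦ N m hmN, zero_mul]
      · rw [psiBar_apply_of_mem hm, hv (S.empty m) ⟨hS, fun h => ?_⟩, mul_zero, mul_zero]
        have : (M : ℤ) = m := h
        omega
    · rw [psiBar_apply_of_notMem hm, mul_zero]

theorem psiBarSmeared_above {f : ℤ → ℂ} {N : ℕ} (h1 : f N = 1) (S : Maya)
    (hS : (N : ℤ) ∈ S.carrier) :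
    psiBarSmeared f (basisState (Maya.above (N + 1))) S = basisState (Maya.above N) S := by
  have hkey : ∀ m : ℤ, S.empty m = Maya.above (N + 1) → m = N := by
    intro m hm
    by_contra hne
    have : (N : ℤ) ∈ (S.empty m).carrier := ⟨hS, fun h => hne h.symm⟩
    rw [hm] at this
    have h2 : ((N + 1 : ℕ) : ℤ) ≤ N := this
    omega
  have hrest : ∀ m : ℤ, m ≠ N →
      f m * psiBarMode m (basisState (Maya.above (N + 1))) S = 0 := by
    intro m hm
    by_cases hmS : m ∈ S.carrier
    · rw [psiBar_apply_of_mem hmS, basisState, if_neg (fun h => hm (hkey m h)), mul_zero, mul_zero]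
    · rw [psiBar_apply_of_notMem hmS, mul_zero]
  rw [psiBarSmeared, finsum_eq_single _ (N : ℤ) hrest, h1, one_mul, psiBar_apply_of_mem hS]
  by_cases hSN : S = Maya.above N
  · subst hSN
    have he : (Maya.above N).empty N = Maya.above (N + 1) := by
      ext j
      constructor
      · rintro ⟨ha, hb⟩
        have ha' : (N : ℤ) ≤ j := ha
        have hb' : j ≠ N := hb
        show ((N + 1 : ℕ) : ℤ) ≤ j
        omega
      · intro ha
        have ha' : ((N + 1 : ℕ) : ℤ) ≤ j := ha
        refine ⟨show (N : ℤ) ≤ j by omega, fun h => ?_⟩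
        have hb' : j = N := h
        omega
    have hs : {j : ℤ | j ∈ (Maya.above N).carrier ∧ j < N} = ∅ := by
      ext j
      constructor
      · rintro ⟨ha, hb⟩
        have ha' : (N : ℤ) ≤ j := ha
        omega
      · intro h
        exact h.elim
    rw [Maya.sign, hs]
    simp [basisState, he]
  · rw [basisState, basisState, if_neg hSN, if_neg, mul_zero]
    intro he
    apply hSN
    ext j
    have hj : j ∈ (S.empty N).carrier ↔ ((N + 1 : ℕ) : ℤ) ≤ j := by rw [he]; rfl
    show _ ↔ (N : ℤ) ≤ j
    by_cases hjN : j = N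
    · subst hjN
      exact ⟨fun _ => le_rfl, fun _ => hS⟩
    · constructor
      · intro h
        have := hj.1 ⟨h, hjN⟩
        omega
      · intro h
        exact (hj.2 (by omega)).1

/-- Each coefficient of the infinite product is eventually constant in `N`. -/
theorem decomposableState_eventually {Φ : ℕ → ℤ → ℂ} (h1 : ∀ k : ℕ, Φ k k = 1)
    (hΦ : ∀ (k : ℕ) (m : ℤ), (k : ℤ) < m → Φ k m = 0) (S : Maya) :
    ∀ᶠ N : ℕ in atTop,
      wedgeApply Φ N (basisState (Maya.above N)) S = decomposableState Φ S := by
  have hstep : ∀ N : ℕ, (N : ℤ) ∈ S.carrier →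
      wedgeApply Φ (N + 1) (basisState (Maya.above (N + 1))) S =
        wedgeApply Φ N (basisState (Maya.above N)) S := by
    intro N hN
    have hdec : psiBarSmeared (Φ N) (basisState (Maya.above (N + 1))) =
        basisState (Maya.above N) + (psiBarSmeared (Φ N) (basisState (Maya.above (N + 1))) -
          basisState (Maya.above N)) := by abel
    show wedgeApply Φ N (psiBarSmeared (Φ N) _) S = _
    rw [hdec, wedgeApply_add hΦ, Pi.add_apply,
      wedgeApply_eq_zero hΦ N (le_refl N) (_ - _) (fun T hT => ?_) S hN, add_zero]
    rw [Pi.sub_apply, psiBarSmeared_above (h1 N) T hT, sub_self]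
  obtain ⟨d, hd⟩ := S.finite_hole.bddAbove
  have hmem : ∀ N : ℕ, (d + 1).toNat ≤ N → (N : ℤ) ∈ S.carrier := by
    intro N hN
    by_contra h
    have : (N : ℤ) ≤ d := hd ⟨h, by omega⟩
    omega
  have hconst : ∀ N : ℕ, (d + 1).toNat ≤ N →
      wedgeApply Φ N (basisState (Maya.above N)) S =
        wedgeApply Φ (d + 1).toNat (basisState (Maya.above (d + 1).toNat)) S := by
    intro N hN
    induction N, hN using Nat.le_induction with
    | base => rfl
    | succ N hN ih => rw [hstep N (hmem N hN), ih]
  have hlim : decomposableState Φ S =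
      wedgeApply Φ (d + 1).toNat (basisState (Maya.above (d + 1).toNat)) S := by
    apply Tendsto.limUnder_eq
    apply tendsto_const_nhds.congr'
    filter_upwards [eventually_ge_atTop (d + 1).toNat] with N hN
    exact (hconst N hN).symm
  filter_upwards [eventually_ge_atTop (d + 1).toNat] with N hN
  rw [hconst N hN, hlim]

/-! ### The `W_{1+∞}` generators -/

/-- The exponent `ν_k` in `c_0(ζ) = (dλ/dζ)^{1/2} ψ(λ) = p^{-1/2} ∑_k ψ_{-k-1/2} ζ^{ν_k}`, where
`ζ = λ^p`; likewise `c̄_0(ζ) = p^{-1/2} ∑_j ψ̄_{j+1/2} ζ^{ν_{-j-1}}`. -/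
def twistedExponent (p : ℕ) (k : ℤ) : ℂ := (2 * (k : ℂ) + 1 - p) / (2 * p)

/-- The Laurent expansion, in `t = ζ₁ - 1` and at `ζ₂ = 1`, of the difference
`(dλ₁/dζ₁)^{1/2} (dλ₂/dζ₂)^{1/2} / (λ₁ - λ₂) - 1 / (ζ₁ - ζ₂)` of the contraction of
`c_0(ζ₁) c̄_0(ζ₂)` in the state `|0⟩` and in the `SL(2,ℂ)`-invariant vacuum of the `ζ`-plane;
here `λ_i = ζ_i^{1/p}`. -/
def contractionDifference (p : ℕ) : LaurentSeries ℂ :=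
  (HahnSeries.ofPowerSeries ℤ ℂ
      ((1 / (p : ℂ)) • PowerSeries.binomialSeries ℂ ((1 - (p : ℂ)) / (2 * p)))) /
    (HahnSeries.ofPowerSeries ℤ ℂ
      (PowerSeries.binomialSeries ℂ (1 / (p : ℂ)) - 1))
  - HahnSeries.single (-1) 1

/-- The value of `W^s_0` on `|0⟩` (the zero-point constant from the normal ordering on the
`ζ`-plane): `s` times the sum over the `p` sheets of the coefficient of `ζ^{-s}` in
`∂_{ζ₁}^{s-1}` of the contraction difference at `ζ₁ = ζ₂ = ζ`. -/
def zeroPoint (p s : ℕ) : ℂ :=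
  (s : ℂ) * p * ((s - 1).factorial : ℂ) * (contractionDifference p).coeff ((s : ℤ) - 1)

/-- The generator
`W^s_n = ∑_{a=0}^{p-1} ∮ dζ/(2πi) s ζ^{n+s-1} :∂^{s-1} c_a(ζ) · c̄_a(ζ):`, `s ≥ 1`, with
`c_a(ζ) = c_0(e^{2πia} ζ)` and `: :` the normal ordering for the `ζ`-plane, in modes.
By the mode expansions, `∂^{s-1} c_0 · c̄_0` is the sum over `k, j` of
`p^{-1} ν_k (ν_k - 1) ⋯ (ν_k - s + 2) ζ^{ν_k + ν_{-j-1} - s + 1} ψ_{-k-1/2} ψ̄_{j+1/2}`, where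
`ν_k + ν_{-j-1} = (k - j)/p - 1`; the sum over the sheets
gives a factor `p` for integral exponents and `0` otherwise, and the integral selects
`j = k + np`. -/
def Wgen (p s : ℕ) (n : ℤ) : Module.End ℂ Fock :=
  (s : ℂ) • bilinear (fun k => (descPochhammer ℂ (s - 1)).eval (twistedExponent p k)) (n * p)
  + (if n = 0 then zeroPoint p s else 0) • 1

/-! ### The initial state

The states at `x = b` and at `x = 0` are related by `|Φ(b)⟩ = exp(A) |Φ⟩` with
`A = (1/g) ∑ b_n α_n`, so the initial state is the formal vector `|Φ⟩ = exp(-A) |Φ(b)⟩`.  (Its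
coefficients on Maya diagrams are in general divergent series.)  An operator `O` acts on formal
vectors of this kind by `O exp(-A) v = exp(-A) (exp(A) O exp(-A)) v`, where
`exp(A) O exp(-A) = ∑_j (1/j!) (ad A)^j O` whenever this series terminates. -/

/-- `A = (1/g) ∑_n b_n α_n`. -/
def evolutionGenerator {N : ℕ} (g : ℂ) (b : Fin N → ℂ) : Module.End ℂ Fock :=
  ∑ i : Fin N, (b i / g) • alpha ((i : ℤ) + 1)

/-- The iterated commutator `(ad A)^j O`. -/
def iteratedAd (A O : Module.End ℂ Fock) (j : ℕ) : Module.End ℂ Fock :=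
  (fun X => A * X - X * A)^[j] O

/-- A formal vector `exp(-A) v`. -/
structure ExpVector where
  /-- The operator `A`. -/
  generator : Module.End ℂ Fock
  /-- The vector `v`. -/
  vector : Fock

/-- `O` annihilates the formal vector `exp(-A) v`: the series `∑_j (1/j!) (ad A)^j O` for
`exp(A) O exp(-A)` terminates, and its sum annihilates `v`. -/
def ExpVector.AnnihilatedBy (Φ : ExpVector) (O : Module.End ℂ Fock) : Prop :=
  ∃ K : ℕ, (∀ j : ℕ, K ≤ j → iteratedAd Φ.generator O j = 0) ∧
    (∑ j ∈ Finset.range K, ((j.factorial : ℂ)⁻¹) • iteratedAd Φ.generator O j) Φ.vector = 0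

/-- The state `|Φ⟩ = exp(-(1/g) ∑ b_n α_n) |Φ(b)⟩` of the initial point
`𝒱 = 𝒱(0) = exp((1/g) ∑ b_n λ^n) 𝒱(b)` of the Grassmannian, where
`|Φ(b)⟩ = ∏_{k ≥ 0} [∮ dλ/(2πi) ψ̄(λ) Φ_k(b; λ)] |Ω⟩`. -/
def initialState {N : ℕ} (hN : 0 < N) (g : ℂ) (b : Fin N → ℂ) (W : PDO (Fun N)) : ExpVector where
  generator := evolutionGenerator g b
  vector := decomposableState (satoFrame hN g W)

end

/-! The point `𝒱(b)` has two symmetries. Since `W ∂^p W⁻¹` is a differential operator, `∂^k W ∂^p`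
is a differential operator times `W`, so `𝒱(b)` is stable under `ζ = λ^p`. The same argument for the
string operator, in which `∂` differentiates the coefficient `x_1`, makes `𝒱(b)` stable under `∂_ζ +
u`. Here `u = (1/(gp)) ∑ n b_n λ^{n-p}`, and `γ = -(p-1)/2` gives exactly the half-density twist in
`∂_ζ : λ^k ↦ ν_k λ^{k-p}` (`band_mem`, `connection_mem`; both rest on `PDO.mul_assoc`).

On one-body operators, conjugation by `e^A` fixes `ζ` and sends `∂_ζ` to `∂_ζ + u`. The conjugate of
`ζ^m ∂_ζ^r` is therefore `ζ^m (∂_ζ + u)^r`, which preserves `𝒱(b)` when `m ≥ 0`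
(`sum_iterated_commutator`). The series terminates on the Fock space because a commutator with
`α_n`, `n > 0`, takes a finite difference of the polynomial coefficients of a bilinear
(`iteratedAd_eq_zero`).

A charge-zero vector killed by all `ψ̄(Φ_k)` is a multiple of the state of the frame. So a
charge-preserving operator whose one-body action preserves `𝒱(b)` has `|Φ(b)⟩` as an eigenvector
(`state_eigenvector`). This leaves the eigenvalue unknown.

The eigenvalue is removed by a commutator. Up to its normalisation, a generator of spin `s` and mode
`n` is `[α_p, B]` with `B` of spin `s + 1` and mode `n - 1`, and the central term of this commutator
is exactly the zero-point constant of the `ζ`-plane normal ordering (`Wgen_eq_commutator`,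
`zeroPoint_eq_sum`). As `α_p` commutes with `A`, the conjugate of the generator is the commutator of
`α_p` with the conjugate `Y` of `B`. Both have `|Φ(b)⟩` as an eigenvector, so their commutator kills
it. The bound `n ≥ -s + 1` is what makes the power `m = n + s - 1` of `ζ` in `B` non-negative. -/

/-! ### Canonical anticommutation relations -/

namespace Maya

theorem finite_below (S : Maya) (k : ℤ) : {j : ℤ | j ∈ S.carrier ∧ j < k}.Finite := by
  refine (S.finite_neg.union (Set.finite_Ico 0 k)).subset ?_
  rintro j ⟨h1, h2⟩
  by_cases h : j < 0
  · exact Or.inl ⟨h1, h⟩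
  · exact Or.inr ⟨by omega, h2⟩

theorem mem_fill {S : Maya} {k j : ℤ} : j ∈ (S.fill k).carrier ↔ j = k ∨ j ∈ S.carrier := Iff.rfl

theorem mem_empty {S : Maya} {k j : ℤ} : j ∈ (S.empty k).carrier ↔ j ∈ S.carrier ∧ j ≠ k := Iff.rfl

theorem fill_empty {S : Maya} {k : ℤ} (h : k ∈ S.carrier) : (S.empty k).fill k = S := by
  ext j
  rw [mem_fill, mem_empty]
  by_cases hj : j = k
  · simp [hj, h]
  · simp [hj]

theorem fill_fill_comm (S : Maya) (j k : ℤ) : (S.fill j).fill k = (S.fill k).fill j := by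
  ext i
  simp only [mem_fill]
  tauto

theorem empty_empty_comm (S : Maya) (j k : ℤ) : (S.empty j).empty k = (S.empty k).empty j := by
  ext i
  simp only [mem_empty]
  tauto

theorem empty_fill_comm (S : Maya) {j k : ℤ} (h : j ≠ k) :
    (S.empty j).fill k = (S.fill k).empty j := by
  ext i
  simp only [mem_empty, mem_fill]
  by_cases hi : i = k
  · subst hi
    simp [h.symm]
  · simp [hi]

/-- The sign counts occupied sites strictly below `j`, so only a change below `j` matters. All
anticommutation signs come from this asymmetry. -/
theorem sign_fill_of_lt {S : Maya} {k j : ℤ} (h : k < j) (hk : k ∉ S.carrier) :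
    (S.fill k).sign j = -S.sign j := by
  have : {i : ℤ | i ∈ (S.fill k).carrier ∧ i < j} =
      insert k {i : ℤ | i ∈ S.carrier ∧ i < j} := by
    ext i
    simp only [mem_fill, Set.mem_ofPred_eq, Set.mem_insert_iff]
    constructor
    · tauto
    · rintro (rfl | h')
      · exact ⟨Or.inl rfl, h⟩
      · exact ⟨Or.inr h'.1, h'.2⟩
  rw [sign, sign, this, Set.ncard_insert_of_notMem (fun h' => hk h'.1) (S.finite_below j), pow_succ]
  ring

theorem sign_fill_of_le (S : Maya) {k j : ℤ} (h : j ≤ k) : (S.fill k).sign j = S.sign j := by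
  have : {i : ℤ | i ∈ (S.fill k).carrier ∧ i < j} = {i : ℤ | i ∈ S.carrier ∧ i < j} := by
    ext i
    simp only [mem_fill, Set.mem_ofPred_eq]
    constructor
    · rintro ⟨rfl | h1, h2⟩
      · omega
      · exact ⟨h1, h2⟩
    · tauto
  rw [sign, sign, this]

theorem sign_empty_of_lt {S : Maya} {k j : ℤ} (h : k < j) (hk : k ∈ S.carrier) :
    (S.empty k).sign j = -S.sign j := by
  have := sign_fill_of_lt (S := S.empty k) h (fun h' => h'.2 rfl)
  rw [fill_empty hk] at this
  rw [this, neg_neg]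

theorem sign_empty_of_le (S : Maya) {k j : ℤ} (h : j ≤ k) : (S.empty k).sign j = S.sign j := by
  have : {i : ℤ | i ∈ (S.empty k).carrier ∧ i < j} = {i : ℤ | i ∈ S.carrier ∧ i < j} := by
    ext i
    simp only [mem_empty, Set.mem_ofPred_eq]
    constructor
    · tauto
    · rintro ⟨h1, h2⟩
      exact ⟨⟨h1, by omega⟩, h2⟩
  rw [sign, sign, this]

end Maya

/-- For `j < k` removing `j` changes the sign attached to `k` but not conversely, so the two orders
differ by exactly one factor `-1`. -/
theorem psiBar_psiBar (j k : ℤ) (v : Fock) :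
    psiBarMode j (psiBarMode k v) = -psiBarMode k (psiBarMode j v) := by
  have key : ∀ j k : ℤ, j < k → ∀ v : Fock,
      psiBarMode j (psiBarMode k v) = -psiBarMode k (psiBarMode j v) := by
    intro j k hjk v
    funext S
    rw [Pi.neg_apply]
    by_cases hj : j ∈ S.carrier
    · by_cases hk : k ∈ S.carrier
      · rw [psiBar_apply_of_mem hj, psiBar_apply_of_mem (S := S.empty j) ⟨hk, hjk.ne'⟩,
          psiBar_apply_of_mem hk, psiBar_apply_of_mem (S := S.empty k) ⟨hj, hjk.ne⟩,
          Maya.empty_empty_comm, Maya.sign_empty_of_lt hjk hj, Maya.sign_empty_of_le S hjk.le]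
        ring
      · rw [psiBar_apply_of_mem hj, psiBar_apply_of_notMem (S := S.empty j) (fun h => hk h.1),
          psiBar_apply_of_notMem hk]
        ring
    · by_cases hk : k ∈ S.carrier
      · rw [psiBar_apply_of_notMem hj, psiBar_apply_of_mem hk,
          psiBar_apply_of_notMem (S := S.empty k) (fun h => hj h.1)]
        ring
      · rw [psiBar_apply_of_notMem hj, psiBar_apply_of_notMem hk, neg_zero]
  rcases lt_trichotomy j k with h | rfl | h
  · exact key j k h v
  · funext S
    have : psiBarMode j (psiBarMode j v) S = 0 := by
      by_cases hj : j ∈ S.carrier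
      · rw [psiBar_apply_of_mem hj, psiBar_apply_of_notMem (S := S.empty j) (fun h => h.2 rfl), mul_zero]
      · exact psiBar_apply_of_notMem hj _
    rw [Pi.neg_apply, this, neg_zero]
  · rw [key k j h, neg_neg]

/-- For equal indices exactly one of the two orders survives on each diagram, with the square of a
sign. For distinct indices the lower site flips the sign of the upper one. -/
theorem psi_psiBar (k j : ℤ) (v : Fock) :
    psiMode k (psiBarMode j v) = (if k = j then (1 : ℂ) else 0) • v - psiBarMode j (psiMode k v) := by
  funext S
  rw [Pi.sub_apply, Pi.smul_apply, smul_eq_mul]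
  rcases eq_or_ne k j with rfl | hkj
  · rw [if_pos rfl]
    by_cases hk : k ∈ S.carrier
    · rw [psi_apply_of_mem hk, psiBar_apply_of_mem hk,
        psi_apply_of_notMem (S := S.empty k) (fun h => h.2 rfl), Maya.fill_empty hk,
        Maya.sign_empty_of_le S le_rfl, ← mul_assoc, Maya.sign_mul_self]
      ring
    · rw [psi_apply_of_notMem hk, psiBar_apply_of_notMem hk,
        psiBar_apply_of_mem (S := S.fill k) (Or.inl rfl), Maya.empty_fill hk,
        Maya.sign_fill_self, ← mul_assoc, Maya.sign_mul_self]
      ring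
  · rw [if_neg hkj]
    by_cases hk : k ∈ S.carrier
    · rw [psi_apply_of_mem hk]
      by_cases hj : j ∈ S.carrier
      · rw [psiBar_apply_of_mem hj, psi_apply_of_mem (S := S.empty j) ⟨hk, hkj⟩]
        ring
      · rw [psiBar_apply_of_notMem hj]
        ring
    · rw [psi_apply_of_notMem hk]
      by_cases hj : j ∈ S.carrier
      · rw [psiBar_apply_of_mem (S := S.fill k) (Or.inr hj), psiBar_apply_of_mem hj,
          psi_apply_of_notMem (S := S.empty j) (fun h => hk h.1), Maya.empty_fill_comm S hkj.symm]
        rcases lt_or_gt_of_ne hkj with h | h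
        · rw [Maya.sign_fill_of_lt h hk, Maya.sign_empty_of_le S h.le]
          ring
        · rw [Maya.sign_fill_of_le S h.le, Maya.sign_empty_of_lt h hj]
          ring
      · rw [psiBar_apply_of_notMem hj, psiBar_apply_of_notMem (S := S.fill k)]
        · ring
        · rintro (h | h)
          · exact hkj h.symm
          · exact hj h

theorem psi_psi (j k : ℤ) (v : Fock) :
    psiMode j (psiMode k v) = -psiMode k (psiMode j v) := by
  have key : ∀ j k : ℤ, j < k → ∀ v : Fock,
      psiMode j (psiMode k v) = -psiMode k (psiMode j v) := by
    intro j k hjk v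
    funext S
    rw [Pi.neg_apply]
    by_cases hj : j ∈ S.carrier
    · rw [psi_apply_of_mem hj]
      by_cases hk : k ∈ S.carrier
      · rw [psi_apply_of_mem hk, neg_zero]
      · rw [psi_apply_of_notMem hk, psi_apply_of_mem (S := S.fill k) (Or.inr hj), mul_zero, neg_zero]
    · rw [psi_apply_of_notMem hj]
      by_cases hk : k ∈ S.carrier
      · rw [psi_apply_of_mem hk, psi_apply_of_mem (S := S.fill j) (Or.inr hk), mul_zero, neg_zero]
      · have hk' : k ∉ (S.fill j).carrier := by
          rintro (h | h)
          · exact hjk.ne' h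
          · exact hk h
        have hj' : j ∉ (S.fill k).carrier := by
          rintro (h | h)
          · exact hjk.ne h
          · exact hj h
        rw [psi_apply_of_notMem hk, psi_apply_of_notMem hk', psi_apply_of_notMem hj',
          Maya.fill_fill_comm, Maya.sign_fill_of_lt hjk hj, Maya.sign_fill_of_le S hjk.le]
        ring
  rcases lt_trichotomy j k with h | rfl | h
  · exact key j k h v
  · funext S
    have : psiMode j (psiMode j v) S = 0 := by
      by_cases hj : j ∈ S.carrier
      · exact psi_apply_of_mem hj _
      · rw [psi_apply_of_notMem hj, psi_apply_of_mem (S := S.fill j) (Or.inl rfl), mul_zero]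
    rw [Pi.neg_apply, this, neg_zero]
  · rw [key k j h, neg_neg]

/-- `[ψ_{-k-1/2} ψ̄_{l+1/2}, ψ̄_{j+1/2}] = -δ_{kj} ψ̄_{l+1/2}`. -/
theorem normalOrdered_psiBar (k l j : ℤ) (v : Fock) :
    normalOrdered k l (psiBarMode j v) =
      psiBarMode j (normalOrdered k l v) - (if k = j then (1 : ℂ) else 0) • psiBarMode l v := by
  simp only [normalOrdered, LinearMap.sub_apply, Module.End.mul_apply, LinearMap.smul_apply,
    Module.End.one_apply, map_sub, map_smul]
  rw [psiBar_psiBar l j, map_neg, psi_psiBar k j]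
  abel

/-- `[ψ_{-k-1/2} ψ̄_{l+1/2}, ψ_{-j-1/2}] = δ_{lj} ψ_{-k-1/2}`. -/
theorem normalOrdered_psi (k l j : ℤ) (v : Fock) :
    normalOrdered k l (psiMode j v) =
      psiMode j (normalOrdered k l v) + (if l = j then (1 : ℂ) else 0) • psiMode k v := by
  have h : psiBarMode l (psiMode j v) =
      (if l = j then (1 : ℂ) else 0) • v - psiMode j (psiBarMode l v) := by
    rw [psi_psiBar j l]
    simp only [eq_comm (a := l)]
    abel
  simp only [normalOrdered, LinearMap.sub_apply, Module.End.mul_apply, LinearMap.smul_apply,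
    Module.End.one_apply, map_sub, map_smul]
  rw [h, map_sub, map_smul, psi_psi k j]
  abel

/-! ### Locality and infinite sums -/

/-- Each coefficient of `x v` depends on finitely many coefficients of `v`. -/
def IsLocal (x : Module.End ℂ Fock) : Prop :=
  ∀ S : Maya, ∃ F : Set Maya, F.Finite ∧ ∀ v : Fock, (∀ T ∈ F, v T = 0) → x v S = 0

/-- In the family `u` only finitely many members contribute to each coefficient. -/
def FockLocallyFinite {ι : Type*} (u : ι → Fock) : Prop :=
  ∀ S : Maya, (Function.support fun i => u i S).Finite

/-- The sum of a locally finite family of vectors. -/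
noncomputable def fockSum {ι : Type*} (u : ι → Fock) : Fock := fun S => ∑ᶠ i, u i S

theorem IsLocal.locallyFinite {x : Module.End ℂ Fock} (hx : IsLocal x) {ι : Type*} {u : ι → Fock}
    (hu : FockLocallyFinite u) : FockLocallyFinite fun i => x (u i) := by
  intro S
  obtain ⟨F, hF, hx⟩ := hx S
  refine (hF.biUnion fun T _ => hu T).subset fun i hi => ?_
  by_contra hcon
  apply hi
  apply hx
  intro T hT
  by_contra h
  exact hcon (Set.mem_biUnion hT h)

/-- Linearity alone does not let an operator pass through an infinite sum in the completed space.
Locality does: at a given diagram, one finite set of indices accounts both for the inputs that are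
read and for the output. -/
theorem IsLocal.map_fockSum {x : Module.End ℂ Fock} (hx : IsLocal x) {ι : Type*} {u : ι → Fock}
    (hu : FockLocallyFinite u) : x (fockSum u) = fockSum fun i => x (u i) := by
  funext S
  have hxu := hx.locallyFinite hu S
  obtain ⟨F, hF, hx⟩ := hx S
  have hG := hF.biUnion fun T _ => hu T
  set J := (hG.union hxu).toFinset
  have h1 : x (fockSum u - ∑ i ∈ J, u i) S = 0 := by
    apply hx
    intro T hT
    rw [Pi.sub_apply, Finset.sum_apply, fockSum, sub_eq_zero]
    apply finsum_eq_sum_of_support_subset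
    intro i hi
    simp only [J, Set.Finite.coe_toFinset]
    exact Or.inl (Set.mem_biUnion hT hi)
  rw [map_sub, Pi.sub_apply, sub_eq_zero, map_sum, Finset.sum_apply] at h1
  rw [h1, fockSum]
  symm
  apply finsum_eq_sum_of_support_subset
  intro i hi
  simp only [J, Set.Finite.coe_toFinset]
  exact Or.inr hi

theorem fockSum_add {ι : Type*} {u w : ι → Fock} (hu : FockLocallyFinite u) (hw : FockLocallyFinite w) :
    (fockSum fun i => u i + w i) = fockSum u + fockSum w := by
  funext S
  exact finsum_add_distrib (hu S) (hw S)

theorem fockSum_sub {ι : Type*} {u w : ι → Fock} (hu : FockLocallyFinite u) (hw : FockLocallyFinite w) :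
    (fockSum fun i => u i - w i) = fockSum u - fockSum w := by
  funext S
  exact finsum_sub_distrib (hu S) (hw S)

theorem fockSum_neg {ι : Type*} (u : ι → Fock) : (fockSum fun i => -u i) = -fockSum u := by
  funext S
  exact finsum_neg_distrib _

theorem fockSum_comp_equiv {ι κ : Type*} (e : ι ≃ κ) (u : κ → Fock) :
    (fockSum fun i => u (e i)) = fockSum u := by
  funext S
  exact finsum_comp_equiv e (f := fun i => u i S)

theorem fockSum_single {ι : Type*} {u : ι → Fock} (i : ι) (h : ∀ j, j ≠ i → u j = 0) :
    fockSum u = u i := by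
  funext S
  exact finsum_eq_single _ i fun j hj => by rw [h j hj]; rfl

theorem isLocal_psiBarMode (k : ℤ) : IsLocal (psiBarMode k) := by
  refine fun S => ⟨{S.empty k}, Set.finite_singleton _, fun v hv => ?_⟩
  by_cases hk : k ∈ S.carrier
  · rw [psiBar_apply_of_mem hk, hv _ rfl, mul_zero]
  · exact psiBar_apply_of_notMem hk v

theorem isLocal_psiMode (k : ℤ) : IsLocal (psiMode k) := by
  refine fun S => ⟨{S.fill k}, Set.finite_singleton _, fun v hv => ?_⟩
  by_cases hk : k ∈ S.carrier
  · exact psi_apply_of_mem hk v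
  · rw [psi_apply_of_notMem hk, hv _ rfl, mul_zero]

theorem IsLocal.mul {x y : Module.End ℂ Fock} (hx : IsLocal x) (hy : IsLocal y) :
    IsLocal (x * y) := by
  intro S
  obtain ⟨F, hF, hx⟩ := hx S
  choose G hG hy using hy
  exact ⟨⋃ T ∈ F, G T, hF.biUnion fun T _ => hG T, fun v hv => hx _ fun T hT =>
    hy T v fun U hU => hv U (Set.mem_biUnion hT hU)⟩

theorem IsLocal.sub {x y : Module.End ℂ Fock} (hx : IsLocal x) (hy : IsLocal y) :
    IsLocal (x - y) := by
  intro S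
  obtain ⟨F, hF, hx⟩ := hx S
  obtain ⟨G, hG, hy⟩ := hy S
  refine ⟨F ∪ G, hF.union hG, fun v hv => ?_⟩
  rw [LinearMap.sub_apply, Pi.sub_apply, hx v fun T hT => hv T (Or.inl hT),
    hy v fun T hT => hv T (Or.inr hT), sub_zero]

theorem isLocal_smul_one (c : ℂ) : IsLocal (c • 1) :=
  fun S => ⟨{S}, Set.finite_singleton _, fun v hv => by
    rw [LinearMap.smul_apply, Pi.smul_apply, Module.End.one_apply, hv S rfl, smul_zero]⟩

theorem isLocal_normalOrdered (k j : ℤ) : IsLocal (normalOrdered k j) :=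
  ((isLocal_psiMode k).mul (isLocal_psiBarMode j)).sub (isLocal_smul_one _)

theorem locallyFinite_bilinear (c : ℤ → ℂ) (m : ℤ) (v : Fock) :
    FockLocallyFinite fun k => c k • normalOrdered k (k + m) v :=
  bilinear_finite c m v

theorem bilinear_eq_fockSum (c : ℤ → ℂ) (m : ℤ) (v : Fock) :
    bilinear c m v = fockSum fun k => c k • normalOrdered k (k + m) v := rfl

/-- Only hops with `k ∉ S` and `k + n ∈ S` contribute at `S`; the first fails for large `k`, the
second for very negative `k`. Since `n ≠ 0`, there is no vacuum subtraction. -/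
theorem isLocal_alpha {n : ℤ} (hn : 0 < n) : IsLocal (alpha n) := by
  intro S
  have hK : {k : ℤ | k ∉ S.carrier ∧ k + n ∈ S.carrier}.Finite := by
    refine ((S.finite_hole.union (S.finite_neg.image fun k => k - n)).union
      (Set.finite_Ico (-n) 0)).subset ?_
    rintro k ⟨h1, h2⟩
    by_cases h : 0 ≤ k
    · exact Or.inl (Or.inl ⟨h1, h⟩)
    · by_cases h' : k + n < 0
      · exact Or.inl (Or.inr ⟨k + n, ⟨h2, h'⟩, by simp⟩)
      · exact Or.inr ⟨by omega, by omega⟩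
  choose F hF hloc using fun k : ℤ => isLocal_normalOrdered k (k + n) S
  refine ⟨⋃ k ∈ {k : ℤ | k ∉ S.carrier ∧ k + n ∈ S.carrier}, F k, hK.biUnion fun k _ => hF k,
    fun v hv => finsum_eq_zero_of_forall_eq_zero fun k => ?_⟩
  rw [one_mul]
  by_cases hk : k ∉ S.carrier ∧ k + n ∈ S.carrier
  · exact hloc k v fun T hT => hv T (Set.mem_biUnion hk hT)
  · rw [normalOrdered_apply, if_neg (by omega), zero_mul, sub_zero]
    by_cases h1 : k ∈ S.carrier
    · exact psi_apply_of_mem h1 _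
    · rw [psi_apply_of_notMem h1, psiBar_apply_of_notMem (S := S.fill k), mul_zero]
      rintro (h | h)
      · omega
      · exact hk ⟨h1, h⟩

/-! ### Commutators of bilinears with the fermion modes -/

/-- `[∑_k c_k ψ_{-k-1/2} ψ̄_{k+m+1/2}, ψ̄_{j+1/2}] = -c_j ψ̄_{j+m+1/2}`. -/
theorem bilinear_psiBarMode (c : ℤ → ℂ) (m j : ℤ) (v : Fock) :
    bilinear c m (psiBarMode j v) =
      psiBarMode j (bilinear c m v) - c j • psiBarMode (j + m) v := by
  have hl := locallyFinite_bilinear c m v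
  have hs : (fockSum fun k => c k • (if k = j then (1 : ℂ) else 0) • psiBarMode (k + m) v) =
      c j • psiBarMode (j + m) v := by
    rw [fockSum_single j fun k hk => by rw [if_neg hk, zero_smul, smul_zero], if_pos rfl, one_smul]
  rw [bilinear_eq_fockSum, bilinear_eq_fockSum, (isLocal_psiBarMode j).map_fockSum hl, ← hs,
    ← fockSum_sub ((isLocal_psiBarMode j).locallyFinite hl)]
  · congr 1
    funext k
    rw [normalOrdered_psiBar, smul_sub, map_smul]
  · refine fun S => (Set.finite_singleton j).subset fun k hk => ?_
    by_contra h
    exact hk (by simp [show k ≠ j from h])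

theorem alpha_psiBarMode (n j : ℤ) (v : Fock) :
    alpha n (psiBarMode j v) = psiBarMode j (alpha n v) - psiBarMode (j + n) v := by
  rw [alpha, bilinear_psiBarMode, one_smul]

theorem alpha_psiMode (n j : ℤ) (v : Fock) :
    alpha n (psiMode j v) = psiMode j (alpha n v) + psiMode (j - n) v := by
  have hl := locallyFinite_bilinear (fun _ => 1) n v
  have hs : (fockSum fun k => (if k + n = j then (1 : ℂ) else 0) • psiMode k v) =
      psiMode (j - n) v := by
    rw [fockSum_single (j - n) fun k hk => by rw [if_neg (by omega), zero_smul],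
      if_pos (by omega), one_smul]
  rw [alpha, bilinear_eq_fockSum, bilinear_eq_fockSum, (isLocal_psiMode j).map_fockSum hl, ← hs,
    ← fockSum_add ((isLocal_psiMode j).locallyFinite hl)]
  · congr 1
    funext k
    rw [normalOrdered_psi, one_smul, one_smul]
  · refine fun S => (Set.finite_singleton (j - n)).subset fun k hk => ?_
    by_contra h
    exact hk (by simp [show k + n ≠ j from fun h' => h (by simp [← h'])])

/-- The commutator of a current mode with a normal ordered bilinear. -/
theorem alpha_normalOrdered (n k l : ℤ) (v : Fock) :
    alpha n (normalOrdered k l v) = normalOrdered k l (alpha n v) +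
      (normalOrdered (k - n) l v - normalOrdered k (l + n) v) +
      ((if k - n = l ∧ k - n < 0 then (1 : ℂ) else 0) -
        (if k = l + n ∧ k < 0 then (1 : ℂ) else 0)) • v := by
  -- The scalar is pure bookkeeping: the products with shifted indices have to be normal ordered
  -- again.
  simp only [normalOrdered, LinearMap.sub_apply, Module.End.mul_apply, LinearMap.smul_apply,
    Module.End.one_apply, map_sub, map_smul]
  rw [alpha_psiMode, alpha_psiBarMode, map_sub, sub_smul]
  abel

/-- The central term of `[α_n, ∑_k c_k ∘ψ_{-k-1/2} ψ̄_{k+m+1/2}∘]` for `n + m = 0`. -/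
theorem alpha_bilinear {n : ℕ} (hn : 0 < n) (c : ℤ → ℂ) (m : ℤ) :
    alpha n * bilinear c m - bilinear c m * alpha n =
      bilinear (fun k => c (k + n) - c k) (m + n) +
        (if m + n = 0 then ∑ k ∈ Finset.range n, c k else 0) • 1 := by
  have hn' : (0 : ℤ) < n := by exact_mod_cast hn
  refine LinearMap.ext fun v => ?_
  simp only [LinearMap.sub_apply, Module.End.mul_apply, LinearMap.add_apply, LinearMap.smul_apply,
    Module.End.one_apply]
  have hl := locallyFinite_bilinear c m v
  have hl' := locallyFinite_bilinear c m (alpha n v)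
  have hl1 := locallyFinite_bilinear (fun k => c (k + n)) (m + n) v
  have hl2 := locallyFinite_bilinear c (m + n) v
  have hs1 : FockLocallyFinite fun k : ℤ => c k • normalOrdered (k - n) (k + m) v := by
    intro S
    refine ((hl1 S).image fun k : ℤ => k + (n : ℤ)).subset fun k hk => ⟨k - n, ?_, by simp⟩
    have : k - n + (m + n) = k + m := by ring
    simpa [this] using hk
  have e1 : (fockSum fun k : ℤ => c (k + n) • normalOrdered k (k + (m + n)) v) =
      fockSum fun k : ℤ => c k • normalOrdered (k - n) (k + m) v := by
    rw [← fockSum_comp_equiv (Equiv.addRight (n : ℤ))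
      fun k => c k • normalOrdered (k - n) (k + m) v]
    congr 1
    funext k
    simp only [Equiv.coe_addRight, add_sub_cancel_right]
    rw [add_assoc k n m, add_comm (n : ℤ) m]
  -- The two vacuum subtractions live on `k < n` and on `k < 0`, so they cancel outside the window
  -- `0 ≤ k < n`. This makes the central term a finite sum.
  have hind : ∀ k : ℤ, ((if k - n = k + m ∧ k - n < 0 then (1 : ℂ) else 0) -
      (if k = k + m + n ∧ k < 0 then (1 : ℂ) else 0)) =
      if m + n = 0 ∧ 0 ≤ k ∧ k < n then 1 else 0 := by
    intro k
    by_cases hm : m + n = 0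
    · rcases lt_or_ge k 0 with h0 | h0
      · rw [if_pos (by omega), if_pos (by omega), if_neg (by omega), sub_self]
      · rcases lt_or_ge k n with h1 | h1
        · rw [if_pos (by omega), if_neg (by omega), if_pos (by omega), sub_zero]
        · rw [if_neg (by omega), if_neg (by omega), if_neg (by omega), sub_zero]
    · rw [if_neg (by omega), if_neg (by omega), if_neg (by omega), sub_zero]
  have hsup : ∀ S : Maya, (Function.support fun k : ℤ =>
      (c k • (if m + n = 0 ∧ 0 ≤ k ∧ k < n then (1 : ℂ) else 0) • v) S) ⊆
        (Finset.Ico (0 : ℤ) n : Set ℤ) := by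
    intro S k hk
    by_contra h
    apply hk
    simp only [Finset.coe_Ico, Set.mem_Ico] at h
    have : ¬ (m + n = 0 ∧ 0 ≤ k ∧ k < n) := fun h' => h h'.2
    simp [this]
  have hs3 : FockLocallyFinite fun k : ℤ =>
      c k • (if m + n = 0 ∧ 0 ≤ k ∧ k < n then (1 : ℂ) else 0) • v :=
    fun S => (Finset.finite_toSet _).subset (hsup S)
  have e3 : (fockSum fun k : ℤ => c k • (if m + n = 0 ∧ 0 ≤ k ∧ k < n then (1 : ℂ) else 0) • v) =
      (if m + n = 0 then ∑ k ∈ Finset.range n, c k else 0) • v := by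
    funext S
    rw [fockSum, finsum_eq_sum_of_support_subset _ (hsup S)]
    have hI : Finset.Ico (0 : ℤ) n = (Finset.range n).map Nat.castEmbedding := by
      ext k
      simp only [Finset.mem_Ico, Finset.mem_map, Finset.mem_range, Nat.castEmbedding_apply]
      constructor
      · rintro ⟨h0, h1⟩
        exact ⟨k.toNat, by omega, by omega⟩
      · rintro ⟨j, hj, rfl⟩
        exact ⟨by omega, by omega⟩
    rw [hI, Finset.sum_map]
    by_cases hm : m + n = 0
    · rw [if_pos hm, Pi.smul_apply, smul_eq_mul, Finset.sum_mul]
      refine Finset.sum_congr rfl fun k hk => ?_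
      have := Finset.mem_range.1 hk
      rw [if_pos ⟨hm, by simp, by simpa using this⟩]
      simp
    · simp [hm]
  rw [bilinear_eq_fockSum c m v, (isLocal_alpha hn').map_fockSum hl]
  have key : (fun k : ℤ => alpha n (c k • normalOrdered k (k + m) v)) = fun k : ℤ =>
      c k • normalOrdered k (k + m) (alpha n v) +
        ((c k • normalOrdered (k - n) (k + m) v - c k • normalOrdered k (k + (m + n)) v) +
        c k • (if m + n = 0 ∧ 0 ≤ k ∧ k < n then (1 : ℂ) else 0) • v) := by
    funext k
    rw [map_smul, alpha_normalOrdered, hind, smul_add, smul_add, smul_sub, add_assoc k m,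
      add_assoc]
  have hsub : FockLocallyFinite fun k : ℤ =>
      c k • normalOrdered (k - n) (k + m) v - c k • normalOrdered k (k + (m + n)) v :=
    fun S => ((hs1 S).union (hl2 S)).subset fun k hk => by
      by_contra h
      simp only [Set.mem_union, Function.mem_support, not_or, not_not] at h
      exact hk (by
        show (c k • normalOrdered (k - n) (k + m) v) S
          - (c k • normalOrdered k (k + (m + n)) v) S = 0
        rw [h.1, h.2, sub_zero])
  have hadd : FockLocallyFinite fun k : ℤ =>
      (c k • normalOrdered (k - n) (k + m) v - c k • normalOrdered k (k + (m + n)) v) +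
        c k • (if m + n = 0 ∧ 0 ≤ k ∧ k < n then (1 : ℂ) else 0) • v :=
    fun S => ((hsub S).union (hs3 S)).subset fun k hk => by
      by_contra h
      simp only [Set.mem_union, Function.mem_support, not_or, not_not] at h
      exact hk (by
        show (c k • normalOrdered (k - n) (k + m) v - c k • normalOrdered k (k + (m + n)) v) S
          + (c k • (if m + n = 0 ∧ 0 ≤ k ∧ k < n then (1 : ℂ) else 0) • v) S = 0
        rw [h.1, h.2, add_zero])
  have e2 : bilinear (fun k => c (k + n) - c k) (m + n) v =
      (fockSum fun k : ℤ => c k • normalOrdered (k - n) (k + m) v) -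
        fockSum fun k : ℤ => c k • normalOrdered k (k + (m + n)) v := by
    rw [← e1, ← fockSum_sub hl1 hl2, bilinear_eq_fockSum]
    congr 1
    funext k
    rw [sub_smul]
  rw [key, fockSum_add hl' hadd, fockSum_add hsub hs3, fockSum_sub hs1 hl2, e3, e2,
    bilinear_eq_fockSum c m (alpha n v)]
  abel

/-! ### Smeared modes and operators that act on them through one-body operators -/

/-- The coefficients `f_m` vanish for large `m`. -/
def BoundedDegree (f : ℤ → ℂ) : Prop := ∃ d : ℤ, ∀ m, d < m → f m = 0

theorem locallyFinite_smeared {f : ℤ → ℂ} (hf : BoundedDegree f) (v : Fock) :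
    FockLocallyFinite fun m => f m • psiBarMode m v := by
  obtain ⟨d, hd⟩ := hf
  exact psiBarSmeared_finite hd v

theorem psiBarSmeared_eq_fockSum (f : ℤ → ℂ) (v : Fock) :
    psiBarSmeared f v = fockSum fun m => f m • psiBarMode m v := rfl

theorem psiBarSmeared_add_left {f h : ℤ → ℂ} (hf : BoundedDegree f) (hh : BoundedDegree h)
    (v : Fock) : psiBarSmeared (f + h) v = psiBarSmeared f v + psiBarSmeared h v := by
  simp only [psiBarSmeared_eq_fockSum, Pi.add_apply, add_smul]
  exact fockSum_add (locallyFinite_smeared hf v) (locallyFinite_smeared hh v)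

theorem psiBarSmeared_smul_left (a : ℂ) (f : ℤ → ℂ) (v : Fock) :
    psiBarSmeared (a • f) v = a • psiBarSmeared f v := by
  funext S
  show ∑ᶠ m, a • f m * psiBarMode m v S = a • ∑ᶠ m, f m * psiBarMode m v S
  rw [smul_finsum]
  simp only [smul_eq_mul, mul_assoc]

theorem psiBarSmeared_zero_left (v : Fock) : psiBarSmeared 0 v = 0 := by
  have := psiBarSmeared_smul_left 0 0 v
  rwa [zero_smul, zero_smul] at this

theorem psiBarSmeared_smul (a : ℂ) (f : ℤ → ℂ) (v : Fock) :
    psiBarSmeared f (a • v) = a • psiBarSmeared f v := by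
  funext S
  show ∑ᶠ m, f m * psiBarMode m (a • v) S = a • ∑ᶠ m, f m * psiBarMode m v S
  rw [smul_finsum]
  refine finsum_congr fun m => ?_
  rw [map_smul, Pi.smul_apply]
  simp only [smul_eq_mul]
  ring

theorem BoundedDegree.add {f h : ℤ → ℂ} (hf : BoundedDegree f) (hh : BoundedDegree h) :
    BoundedDegree (f + h) := by
  obtain ⟨d, hd⟩ := hf
  obtain ⟨e, he⟩ := hh
  exact ⟨max d e, fun m hm => by
    rw [Pi.add_apply, hd m (lt_of_le_of_lt (le_max_left _ _) hm),
      he m (lt_of_le_of_lt (le_max_right _ _) hm), add_zero]⟩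

theorem BoundedDegree.smul {f : ℤ → ℂ} (hf : BoundedDegree f) (a : ℂ) :
    BoundedDegree (a • f) := by
  obtain ⟨d, hd⟩ := hf
  exact ⟨d, fun m hm => by rw [Pi.smul_apply, hd m hm, smul_zero]⟩

theorem boundedDegree_zero : BoundedDegree 0 := ⟨0, fun _ _ => rfl⟩

/-- The smeared mode as a linear operator. -/
noncomputable def smearedEnd (f : ℤ → ℂ) (hf : BoundedDegree f) : Module.End ℂ Fock where
  toFun := psiBarSmeared f
  map_add' u v := by
    obtain ⟨d, hd⟩ := hf
    exact psiBarSmeared_add hd u v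
  map_smul' a v := psiBarSmeared_smul a f v

/-- The component at `S` reads `v` only at `S` with one site `m ≤ d` removed, and `S` has finitely
many such sites. -/
theorem isLocal_smearedEnd {f : ℤ → ℂ} (hf : BoundedDegree f) : IsLocal (smearedEnd f hf) := by
  obtain ⟨d, hd⟩ := id hf
  intro S
  have hfin : {m : ℤ | m ∈ S.carrier ∧ m < d + 1}.Finite := S.finite_below (d + 1)
  refine ⟨S.empty '' {m : ℤ | m ∈ S.carrier ∧ m < d + 1}, hfin.image _, fun v hv => ?_⟩
  refine finsum_eq_zero_of_forall_eq_zero fun m => ?_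
  by_cases hm : m ∈ S.carrier
  · by_cases hmd : m < d + 1
    · rw [psiBar_apply_of_mem hm, hv _ ⟨m, ⟨hm, hmd⟩, rfl⟩, mul_zero, mul_zero]
    · rw [hd m (by omega), zero_mul]
  · rw [psiBar_apply_of_notMem hm, mul_zero]

theorem psiBarSmeared_anticomm {f h : ℤ → ℂ} (hf : BoundedDegree f) (hh : BoundedDegree h)
    (v : Fock) : psiBarSmeared f (psiBarSmeared h v) = -psiBarSmeared h (psiBarSmeared f v) := by
  have h1 : ∀ j, psiBarMode j (psiBarSmeared h v) = -psiBarSmeared h (psiBarMode j v) := by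
    intro j
    rw [psiBarSmeared_eq_fockSum, (isLocal_psiBarMode j).map_fockSum (locallyFinite_smeared hh v),
      psiBarSmeared_eq_fockSum, ← fockSum_neg]
    congr 1
    funext m
    rw [map_smul, psiBar_psiBar, smul_neg]
  rw [psiBarSmeared_eq_fockSum f]
  simp only [h1, smul_neg]
  rw [fockSum_neg]
  congr 1
  have := (isLocal_smearedEnd hh).map_fockSum (locallyFinite_smeared hf v)
  simp only [map_smul] at this
  exact this.symm

/-- `x` acts on the smeared modes through the one-body operator `T`:
`[x, ψ̄(f)] = ψ̄(T f)`. -/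
def Implements (x : Module.End ℂ Fock) (T : Module.End ℂ (ℤ → ℂ)) : Prop :=
  ∀ f : ℤ → ℂ, BoundedDegree f → BoundedDegree (T f) ∧
    ∀ v, x (psiBarSmeared f v) = psiBarSmeared f (x v) + psiBarSmeared (T f) v

namespace Implements

variable {x y : Module.End ℂ Fock} {T U : Module.End ℂ (ℤ → ℂ)}

theorem add (hx : Implements x T) (hy : Implements y U) : Implements (x + y) (T + U) := by
  intro f hf
  refine ⟨(hx f hf).1.add (hy f hf).1, fun v => ?_⟩
  rw [LinearMap.add_apply, LinearMap.add_apply, LinearMap.add_apply, (hx f hf).2, (hy f hf).2,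
    psiBarSmeared_add_left (hx f hf).1 (hy f hf).1]
  have := (smearedEnd f hf).map_add (x v) (y v)
  change psiBarSmeared f _ = psiBarSmeared f _ + psiBarSmeared f _ at this
  rw [this]
  abel

theorem smul (hx : Implements x T) (a : ℂ) : Implements (a • x) (a • T) := by
  intro f hf
  refine ⟨(hx f hf).1.smul a, fun v => ?_⟩
  rw [LinearMap.smul_apply, LinearMap.smul_apply, LinearMap.smul_apply, (hx f hf).2,
    psiBarSmeared_smul_left, psiBarSmeared_smul, smul_add]

theorem zero : Implements 0 0 := by
  intro f hf
  refine ⟨boundedDegree_zero, fun v => ?_⟩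
  have := (smearedEnd f hf).map_zero
  change psiBarSmeared f 0 = 0 at this
  simp only [LinearMap.zero_apply, psiBarSmeared_zero_left, this, add_zero]

theorem sum {ι : Type*} (s : Finset ι) {x : ι → Module.End ℂ Fock}
    {T : ι → Module.End ℂ (ℤ → ℂ)} (h : ∀ i ∈ s, Implements (x i) (T i)) :
    Implements (∑ i ∈ s, x i) (∑ i ∈ s, T i) := by
  classical
  induction s using Finset.induction_on with
  | empty => exact zero
  | insert i s hi ih =>
    rw [Finset.sum_insert hi, Finset.sum_insert hi]
    exact (h i (Finset.mem_insert_self i s)).add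
      (ih fun j hj => h j (Finset.mem_insert_of_mem hj))

/-- This is the Jacobi identity. Boundedness of `T f` is part of `Implements` so that the one-body
actions can be composed here. -/
theorem commutator (hx : Implements x T) (hy : Implements y U) :
    Implements (x * y - y * x) (T * U - U * T) := by
  intro f hf
  have hTU := (hx _ (hy f hf).1).1
  have hUT := (hy _ (hx f hf).1).1
  have hneg : BoundedDegree (-(U (T f))) := by
    have := hUT.smul (-1)
    rwa [neg_one_smul] at this
  refine ⟨?_, fun v => ?_⟩
  · show BoundedDegree (T (U f) - U (T f))
    rw [sub_eq_add_neg]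
    exact hTU.add hneg
  · have e : psiBarSmeared ((T * U - U * T) f) v =
        psiBarSmeared (T (U f)) v - psiBarSmeared (U (T f)) v := by
      show psiBarSmeared (T (U f) - U (T f)) v = _
      rw [sub_eq_add_neg, psiBarSmeared_add_left hTU hneg, ← neg_one_smul ℂ (U (T f)),
        psiBarSmeared_smul_left, neg_one_smul, sub_eq_add_neg]
    have e' := (smearedEnd f hf).map_sub (x (y v)) (y (x v))
    change psiBarSmeared f _ = psiBarSmeared f _ - psiBarSmeared f _ at e'
    simp only [LinearMap.sub_apply, Module.End.mul_apply] at e ⊢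
    rw [e, e', (hy f hf).2, (hx f hf).2, map_add, map_add, (hx f hf).2, (hy f hf).2,
      (hx _ (hy f hf).1).2, (hy _ (hx f hf).1).2]
    abel

theorem iteratedAd (hx : Implements x T) (hy : Implements y U) (j : ℕ) :
    Implements (iteratedAd x y j) ((fun X => T * X - X * T)^[j] U) := by
  induction j with
  | zero => exact hy
  | succ j ih =>
    rw [_root_.iteratedAd, Function.iterate_succ_apply', Function.iterate_succ_apply']
    exact hx.commutator ih

end Implements

/-- The one-body operator `λ^k ↦ c_k λ^{k+m}`. -/
def band (c : ℤ → ℂ) (m : ℤ) : Module.End ℂ (ℤ → ℂ) where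
  toFun f i := c (i - m) * f (i - m)
  map_add' f h := by
    funext i
    simp [mul_add]
  map_smul' a f := by
    funext i
    simp [mul_left_comm]

theorem band_apply (c : ℤ → ℂ) (m : ℤ) (f : ℤ → ℂ) (i : ℤ) :
    band c m f i = c (i - m) * f (i - m) := rfl

theorem normalOrdered_psiBarSmeared {f : ℤ → ℂ} (hf : BoundedDegree f) (k l : ℤ) (v : Fock) :
    normalOrdered k l (psiBarSmeared f v) =
      psiBarSmeared f (normalOrdered k l v) - f k • psiBarMode l v := by
  have hl := locallyFinite_smeared hf v
  have hl' := locallyFinite_smeared hf (normalOrdered k l v)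
  have hz : ∀ j, j ≠ k → f j • (if k = j then (1 : ℂ) else 0) • psiBarMode l v = 0 := by
    intro j hj
    rw [if_neg hj.symm, zero_smul, smul_zero]
  have hs : FockLocallyFinite fun j => f j • (if k = j then (1 : ℂ) else 0) • psiBarMode l v := by
    refine fun S => (Set.finite_singleton k).subset fun j hj => ?_
    by_contra h
    exact hj (congrFun (hz j h) S)
  have e : (fockSum fun j => f j • (if k = j then (1 : ℂ) else 0) • psiBarMode l v) =
      f k • psiBarMode l v := by
    rw [fockSum_single k hz, if_pos rfl, one_smul]
  rw [psiBarSmeared_eq_fockSum, (isLocal_normalOrdered k l).map_fockSum hl, ← e,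
    psiBarSmeared_eq_fockSum, ← fockSum_sub hl' hs]
  congr 1
  funext j
  rw [map_smul, normalOrdered_psiBar, smul_sub]

/-- The minus sign comes from `[ψ_{-k-1/2} ψ̄_{l+1/2}, ψ̄_{j+1/2}] = -δ_{kj} ψ̄_{l+1/2}`; the normal
ordering constant drops out of the commutator. -/
theorem implements_bilinear (c : ℤ → ℂ) (m : ℤ) : Implements (bilinear c m) (-band c m) := by
  intro f hf
  have hb : BoundedDegree (band c m f) := by
    obtain ⟨d, hd⟩ := hf
    exact ⟨d + m, fun i hi => by rw [band_apply, hd _ (by omega), mul_zero]⟩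
  rw [LinearMap.neg_apply, ← neg_one_smul ℂ (band c m f)]
  refine ⟨hb.smul _, fun v => ?_⟩
  rw [psiBarSmeared_smul_left, neg_one_smul, ← sub_eq_add_neg]
  have hl := locallyFinite_bilinear c m v
  have hb' := locallyFinite_smeared hb v
  have e1 : psiBarSmeared (band c m f) v =
      fockSum fun j => (c j * f j) • psiBarMode (j + m) v := by
    rw [psiBarSmeared_eq_fockSum, ← fockSum_comp_equiv (Equiv.addRight m)]
    congr 1
    funext j
    simp [band_apply]
  have hl1 : FockLocallyFinite fun j => (c j * f j) • psiBarMode (j + m) v := by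
    intro S
    refine ((hb' S).image fun j => j - m).subset fun j hj => ⟨j + m, ?_, by simp⟩
    simpa [band_apply] using hj
  have e2 := (isLocal_smearedEnd hf).map_fockSum hl
  have hl2 := (isLocal_smearedEnd hf).locallyFinite hl
  change psiBarSmeared f (bilinear c m v) = _ at e2
  rw [e1, e2, bilinear_eq_fockSum, ← fockSum_sub hl2 hl1]
  congr 1
  funext k
  rw [normalOrdered_psiBarSmeared hf, smul_sub, smul_smul, map_smul]
  rfl

/-! ### Charge -/

namespace Maya

/-- The charge of a Maya diagram relative to `{0, 1, 2, …}`. -/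
noncomputable def charge (S : Maya) : ℤ :=
  ({k : ℤ | k ∈ S.carrier ∧ k < 0}.ncard : ℤ) - {k : ℤ | k ∉ S.carrier ∧ 0 ≤ k}.ncard

theorem charge_fill {S : Maya} {k : ℤ} (hk : k ∉ S.carrier) :
    (S.fill k).charge = S.charge + 1 := by
  by_cases h0 : k < 0
  · have h1 : {j : ℤ | j ∈ (S.fill k).carrier ∧ j < 0} =
        insert k {j : ℤ | j ∈ S.carrier ∧ j < 0} := by
      ext j
      simp only [mem_fill, Set.mem_ofPred_eq, Set.mem_insert_iff]
      constructor
      · tauto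
      · rintro (rfl | h)
        · exact ⟨Or.inl rfl, h0⟩
        · exact ⟨Or.inr h.1, h.2⟩
    have h2 : {j : ℤ | j ∉ (S.fill k).carrier ∧ 0 ≤ j} = {j : ℤ | j ∉ S.carrier ∧ 0 ≤ j} := by
      ext j
      simp only [mem_fill, Set.mem_ofPred_eq, not_or]
      constructor
      · tauto
      · rintro ⟨h, h'⟩
        exact ⟨⟨by omega, h⟩, h'⟩
    rw [charge, charge, h1, h2, Set.ncard_insert_of_notMem (fun h => hk h.1) S.finite_neg]
    push_cast
    ring
  · have h1 : {j : ℤ | j ∈ (S.fill k).carrier ∧ j < 0} = {j : ℤ | j ∈ S.carrier ∧ j < 0} := by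
      ext j
      simp only [mem_fill, Set.mem_ofPred_eq]
      constructor
      · rintro ⟨rfl | h, h'⟩
        · exact absurd h' h0
        · exact ⟨h, h'⟩
      · tauto
    have h2 : {j : ℤ | j ∉ S.carrier ∧ 0 ≤ j} =
        insert k {j : ℤ | j ∉ (S.fill k).carrier ∧ 0 ≤ j} := by
      ext j
      simp only [mem_fill, Set.mem_ofPred_eq, not_or, Set.mem_insert_iff]
      constructor
      · rintro ⟨h, h'⟩
        by_cases hj : j = k
        · exact Or.inl hj
        · exact Or.inr ⟨⟨hj, h⟩, h'⟩
      · rintro (rfl | h)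
        · exact ⟨hk, by omega⟩
        · exact ⟨h.1.2, h.2⟩
    rw [charge, charge, h1, h2, Set.ncard_insert_of_notMem (fun h => h.1 (Or.inl rfl))
      (S.fill k).finite_hole]
    push_cast
    ring

theorem charge_empty {S : Maya} {k : ℤ} (hk : k ∈ S.carrier) :
    (S.empty k).charge = S.charge - 1 := by
  have := charge_fill (S := S.empty k) (fun h => h.2 rfl)
  rw [fill_empty hk] at this
  omega

theorem charge_above (N : ℕ) : (above N).charge = -N := by
  have h1 : {j : ℤ | j ∈ (above N).carrier ∧ j < 0} = ∅ := by
    ext j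
    simp only [above, Set.mem_ofPred_eq, Set.mem_empty_iff_false, iff_false, not_and]
    omega
  have h2 : {j : ℤ | j ∉ (above N).carrier ∧ 0 ≤ j} = ((Finset.Ico (0 : ℤ) N : Finset ℤ) : Set ℤ) := by
    ext j
    simp only [above, Set.mem_ofPred_eq, Finset.coe_Ico, Set.mem_Ico]
    omega
  rw [charge, h1, h2, Set.ncard_coe_finset]
  simp

theorem eq_above_zero {S : Maya} (hS : S.charge = 0) (h : ∀ k : ℤ, 0 ≤ k → k ∈ S.carrier) :
    S = above 0 := by
  have h2 : {j : ℤ | j ∉ S.carrier ∧ 0 ≤ j} = ∅ := by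
    ext j
    simp only [Set.mem_ofPred_eq, Set.mem_empty_iff_false, iff_false, not_and]
    exact fun h1 h0 => h1 (h j h0)
  rw [charge, h2, Set.ncard_empty, Nat.cast_zero, sub_zero, Nat.cast_eq_zero,
    Set.ncard_eq_zero S.finite_neg] at hS
  ext j
  constructor
  · intro hj
    show ((0 : ℕ) : ℤ) ≤ j
    by_contra hneg
    have : j ∈ {k : ℤ | k ∈ S.carrier ∧ k < 0} := ⟨hj, by omega⟩
    rw [hS] at this
    exact this
  · intro hj
    have hj' : ((0 : ℕ) : ℤ) ≤ j := hj
    exact h j (by omega)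

end Maya

/-- `v` is a combination of basis states of charge `q`. -/
def HasCharge (q : ℤ) (v : Fock) : Prop := ∀ S : Maya, v S ≠ 0 → S.charge = q

theorem HasCharge.psiBarMode {q : ℤ} {v : Fock} (hv : HasCharge q v) (k : ℤ) :
    HasCharge (q + 1) (psiBarMode k v) := by
  intro S hS
  by_cases hk : k ∈ S.carrier
  · rw [psiBar_apply_of_mem hk] at hS
    have h1 := hv _ (right_ne_zero_of_mul hS)
    rw [Maya.charge_empty hk] at h1
    omega
  · exact absurd (psiBar_apply_of_notMem hk v) hS

theorem HasCharge.psiMode {q : ℤ} {v : Fock} (hv : HasCharge q v) (k : ℤ) :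
    HasCharge (q - 1) (psiMode k v) := by
  intro S hS
  by_cases hk : k ∈ S.carrier
  · exact absurd (psi_apply_of_mem hk v) hS
  · rw [psi_apply_of_notMem hk] at hS
    have h1 := hv _ (right_ne_zero_of_mul hS)
    rw [Maya.charge_fill hk] at h1
    omega

theorem HasCharge.fockSum {ι : Type*} {q : ℤ} {u : ι → Fock} (hu : ∀ i, HasCharge q (u i)) :
    HasCharge q (fockSum u) := by
  intro S hS
  obtain ⟨i, hi⟩ : ∃ i, u i S ≠ 0 := by
    by_contra! h
    exact hS (finsum_eq_zero_of_forall_eq_zero h)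
  exact hu i S hi

theorem HasCharge.smul {q : ℤ} {v : Fock} (hv : HasCharge q v) (a : ℂ) : HasCharge q (a • v) :=
  fun S hS => hv S (right_ne_zero_of_mul hS)

theorem HasCharge.add {q : ℤ} {u v : Fock} (hu : HasCharge q u) (hv : HasCharge q v) :
    HasCharge q (u + v) := by
  intro S hS
  by_cases h : u S = 0
  · refine hv S fun h' => hS ?_
    rw [Pi.add_apply, h, h', add_zero]
  · exact hu S h

theorem HasCharge.sub {q : ℤ} {u v : Fock} (hu : HasCharge q u) (hv : HasCharge q v) :
    HasCharge q (u - v) := by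
  have := hu.add (hv.smul (-1))
  rwa [neg_one_smul, ← sub_eq_add_neg] at this

theorem HasCharge.psiBarSmeared {q : ℤ} {v : Fock} (hv : HasCharge q v) (f : ℤ → ℂ) :
    HasCharge (q + 1) (psiBarSmeared f v) :=
  HasCharge.fockSum fun m => (hv.psiBarMode m).smul (f m)

theorem HasCharge.normalOrdered {q : ℤ} {v : Fock} (hv : HasCharge q v) (k j : ℤ) :
    HasCharge q (normalOrdered k j v) := by
  have h := (hv.psiBarMode j).psiMode k
  rw [add_sub_cancel_right] at h
  exact h.sub (hv.smul _)

/-- Operators that preserve the vectors of charge zero. -/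
def chargeZeroOps : Subalgebra ℂ (Module.End ℂ Fock) where
  carrier := {x | ∀ v, HasCharge 0 v → HasCharge 0 (x v)}
  mul_mem' hx hy v hv := hx _ (hy v hv)
  add_mem' hx hy v hv := (hx v hv).add (hy v hv)
  algebraMap_mem' a _ hv := hv.smul a

theorem bilinear_mem_chargeZeroOps (c : ℤ → ℂ) (m : ℤ) : bilinear c m ∈ chargeZeroOps :=
  fun _ hv => HasCharge.fockSum fun k => (hv.normalOrdered k (k + m)).smul (c k)

theorem iteratedAd_mem_chargeZeroOps {x y : Module.End ℂ Fock} (hx : x ∈ chargeZeroOps)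
    (hy : y ∈ chargeZeroOps) (j : ℕ) : iteratedAd x y j ∈ chargeZeroOps := by
  induction j with
  | zero => exact hy
  | succ j ih =>
    rw [iteratedAd, Function.iterate_succ_apply']
    exact sub_mem (mul_mem hx ih) (mul_mem ih hx)

/-! ### The state of a frame as the vector annihilated by the frame -/

/-- `Φ_k = λ^k + (lower powers)`. -/
structure IsFrame (Φ : ℕ → ℤ → ℂ) : Prop where
  leading : ∀ k : ℕ, Φ k k = 1
  lower : ∀ (k : ℕ) (m : ℤ), (k : ℤ) < m → Φ k m = 0

namespace IsFrame

variable {Φ : ℕ → ℤ → ℂ}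

theorem boundedDegree (hΦ : IsFrame Φ) (k : ℕ) : BoundedDegree (Φ k) := ⟨k, hΦ.lower k⟩

theorem hasCharge_wedgeApply (N : ℕ) {q : ℤ} {v : Fock} (hv : HasCharge q v) :
    HasCharge (q + N) (wedgeApply Φ N v) := by
  induction N generalizing q v with
  | zero => simpa [wedgeApply] using hv
  | succ N ih =>
    have := ih (hv.psiBarSmeared (Φ N))
    have e : q + 1 + (N : ℤ) = q + ((N + 1 : ℕ) : ℤ) := by
      push_cast
      ring
    rwa [e] at this

theorem hasCharge_state (hΦ : IsFrame Φ) : HasCharge 0 (decomposableState Φ) := by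
  intro S hS
  obtain ⟨N, hN⟩ := (decomposableState_eventually hΦ.leading hΦ.lower S).exists
  have hb : HasCharge (-N) (basisState (Maya.above N)) := by
    intro T hT
    by_cases h : T = Maya.above N
    · rw [h, Maya.charge_above]
    · exact absurd (if_neg h) hT
  have := hasCharge_wedgeApply (Φ := Φ) N hb
  rw [neg_add_cancel] at this
  exact this S (hN ▸ hS)

/-- Only leading terms reach the vacuum component: the remainder has no component with site `N`
occupied, and the other factors, of degree below `N`, cannot fill it. -/
theorem state_above_zero (hΦ : IsFrame Φ) : decomposableState Φ (Maya.above 0) = 1 := by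
  have hall : ∀ N : ℕ, wedgeApply Φ N (basisState (Maya.above N)) (Maya.above 0) = 1 := by
    intro N
    induction N with
    | zero => exact if_pos rfl
    | succ N ih =>
      have hmem : (N : ℤ) ∈ (Maya.above 0).carrier := by
        show ((0 : ℕ) : ℤ) ≤ N
        omega
      have hdec : psiBarSmeared (Φ N) (basisState (Maya.above (N + 1))) =
          basisState (Maya.above N) + (psiBarSmeared (Φ N) (basisState (Maya.above (N + 1))) -
            basisState (Maya.above N)) := by abel
      show wedgeApply Φ N (psiBarSmeared (Φ N) _) _ = _
      rw [hdec, wedgeApply_add hΦ.lower, Pi.add_apply, ih,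
        wedgeApply_eq_zero hΦ.lower N (le_refl N) (_ - _) (fun T hT => ?_) _ hmem, add_zero]
      rw [Pi.sub_apply, psiBarSmeared_above (hΦ.leading N) T hT, sub_self]
  obtain ⟨N, hN⟩ := (decomposableState_eventually hΦ.leading hΦ.lower (Maya.above 0)).exists
  rw [← hN, hall]

/-- `ψ̄(Φ_k)` anticommutes through the product until it meets its own copy, and it squares to zero.
The accumulated sign is irrelevant, so it is kept as an unspecified scalar. -/
theorem psiBarSmeared_wedgeApply (hΦ : IsFrame Φ) {k N : ℕ} (hk : k < N) (v : Fock) :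
    psiBarSmeared (Φ k) (wedgeApply Φ N v) = 0 := by
  have hself : ∀ k u, psiBarSmeared (Φ k) (psiBarSmeared (Φ k) u) = 0 := fun k u =>
    self_eq_neg.1 (psiBarSmeared_anticomm (hΦ.boundedDegree k) (hΦ.boundedDegree k) u)
  have hzero : ∀ M : ℕ, wedgeApply Φ M 0 = 0 := by
    intro M
    have := wedgeApply_add hΦ.lower M 0 0
    rw [add_zero] at this
    exact left_eq_add.1 this
  have hneg : ∀ (M : ℕ) (u : Fock), wedgeApply Φ M (-u) = -wedgeApply Φ M u := by
    intro M u
    rw [eq_neg_iff_add_eq_zero, ← wedgeApply_add hΦ.lower, neg_add_cancel, hzero]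
  have hcomm : ∀ (M : ℕ) (u : Fock), ∃ a : ℂ, psiBarSmeared (Φ k) (wedgeApply Φ M u) =
      a • wedgeApply Φ M (psiBarSmeared (Φ k) u) := by
    intro M
    induction M with
    | zero => exact fun u => ⟨1, (one_smul _ _).symm⟩
    | succ M ih =>
      intro u
      obtain ⟨a, ha⟩ := ih (psiBarSmeared (Φ M) u)
      refine ⟨-a, ?_⟩
      show psiBarSmeared (Φ k) (wedgeApply Φ M _) = -a • wedgeApply Φ M _
      rw [ha, psiBarSmeared_anticomm (hΦ.boundedDegree k) (hΦ.boundedDegree M), hneg, smul_neg,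
        neg_smul]
  induction N generalizing v with
  | zero => omega
  | succ N ih =>
    rcases Nat.lt_succ_iff_lt_or_eq.1 hk with h | rfl
    · exact ih h _
    · obtain ⟨a, ha⟩ := hcomm k (psiBarSmeared (Φ k) v)
      show psiBarSmeared (Φ k) (wedgeApply Φ k _) = 0
      rw [ha, hself, hzero, smul_zero]

/-- By locality one component involves finitely many coefficients of the infinite product, and these
already agree with a finite product containing the factor `Φ_k`. -/
theorem psiBarSmeared_state (hΦ : IsFrame Φ) (k : ℕ) :
    psiBarSmeared (Φ k) (decomposableState Φ) = 0 := by
  funext S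
  obtain ⟨F, hF, hloc⟩ := isLocal_smearedEnd (hΦ.boundedDegree k) S
  have hev : ∀ᶠ N : ℕ in atTop, ∀ T ∈ F,
      wedgeApply Φ N (basisState (Maya.above N)) T = decomposableState Φ T :=
    (eventually_all_finite hF).2 fun T _ => decomposableState_eventually hΦ.leading hΦ.lower T
  obtain ⟨N, hN, hkN⟩ := (hev.and (eventually_gt_atTop k)).exists
  have h0 := hloc (decomposableState Φ - wedgeApply Φ N (basisState (Maya.above N)))
    fun T hT => by rw [Pi.sub_apply, hN T hT, sub_self]
  rw [map_sub, Pi.sub_apply, sub_eq_zero] at h0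
  exact h0.trans (congrFun (hΦ.psiBarSmeared_wedgeApply hkN _) S)

/-- Triangularity of the frame expresses each coefficient through those on diagrams with holes only
at lower non-negative sites. A charge-zero diagram without such holes is the vacuum. The charge
condition is needed: `ψ̄_r |Φ⟩` is also killed by the frame, in charge one. -/
theorem eq_zero_of_annihilated (hΦ : IsFrame Φ) {w : Fock} (hw : HasCharge 0 w)
    (hvac : w (Maya.above 0) = 0) (h : ∀ k : ℕ, psiBarSmeared (Φ k) w = 0) : w = 0 := by
  have key : ∀ (d : ℕ) (S : Maya), (∀ k : ℤ, (d : ℤ) ≤ k → k ∈ S.carrier) → w S = 0 := by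
    intro d
    induction d with
    | zero =>
      intro S hS
      by_contra hne
      rw [Maya.eq_above_zero (hw S hne) fun k hk => hS k (by omega)] at hne
      exact hne hvac
    | succ d ih =>
      intro S hS
      by_cases hd : (d : ℤ) ∈ S.carrier
      · refine ih S fun k hk => ?_
        rcases hk.eq_or_lt with rfl | hk
        · exact hd
        · exact hS k (by push_cast; omega)
      -- In this component the leading term `m = d` gives `± w S`; terms with `m < d` keep every
      -- site from `d` upward and vanish by induction; those with `m > d` have zero coefficient.
      · have h1 := congrFun (h d) (S.fill d)
        rw [psiBarSmeared, finsum_eq_single _ (d : ℤ), hΦ.leading, one_mul,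
          psiBar_apply_of_mem (S := S.fill d) (Or.inl rfl), Maya.empty_fill hd] at h1
        · refine (mul_eq_zero.1 h1).resolve_left fun h0 => ?_
          have := Maya.sign_mul_self (S.fill d) d
          rw [h0, mul_zero] at this
          exact zero_ne_one this
        · intro m hm
          rcases lt_or_gt_of_ne hm with hm | hm
          · by_cases hmem : m ∈ (S.fill d).carrier
            · rw [psiBar_apply_of_mem hmem, ih, mul_zero, mul_zero]
              intro k hk
              refine ⟨?_, ?_⟩
              · rcases hk.eq_or_lt with rfl | hk
                · exact Or.inl rfl
                · exact Or.inr (hS k (by push_cast; omega))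
              · rintro rfl
                omega
            · rw [psiBar_apply_of_notMem hmem, mul_zero]
          · rw [hΦ.lower d m hm, zero_mul]
  funext S
  obtain ⟨d, hd⟩ := S.finite_hole.bddAbove
  refine key (d + 1).toNat S fun k hk => ?_
  by_contra hk'
  have : k ≤ d := hd ⟨hk', by omega⟩
  omega

/-- An operator of charge zero that acts through a one-body operator preserving the span of the
frame has the state of the frame as an eigenvector. -/
theorem state_eigenvector (hΦ : IsFrame Φ) {x : Module.End ℂ Fock}
    {T : Module.End ℂ (ℤ → ℂ)} (hx : Implements x T) (hx0 : x ∈ chargeZeroOps)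
    (hT : ∀ f ∈ Submodule.span ℂ (Set.range Φ), T f ∈ Submodule.span ℂ (Set.range Φ)) :
    ∃ a : ℂ, x (decomposableState Φ) = a • decomposableState Φ := by
  have hspan : ∀ f ∈ Submodule.span ℂ (Set.range Φ),
      BoundedDegree f ∧ psiBarSmeared f (decomposableState Φ) = 0 := by
    intro f hf
    induction hf using Submodule.span_induction with
    | mem f hf =>
      obtain ⟨k, rfl⟩ := hf
      exact ⟨hΦ.boundedDegree k, hΦ.psiBarSmeared_state k⟩
    | zero => exact ⟨boundedDegree_zero, psiBarSmeared_zero_left _⟩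
    | add f h _ _ hf hh =>
      exact ⟨hf.1.add hh.1, by rw [psiBarSmeared_add_left hf.1 hh.1, hf.2, hh.2, add_zero]⟩
    | smul a f _ hf => exact ⟨hf.1.smul a, by rw [psiBarSmeared_smul_left, hf.2, smul_zero]⟩
  -- The state has vacuum component `1`, which forces this eigenvalue.
  set a := x (decomposableState Φ) (Maya.above 0) with ha
  refine ⟨a, sub_eq_zero.1 (hΦ.eq_zero_of_annihilated
    ((hx0 _ hΦ.hasCharge_state).sub (hΦ.hasCharge_state.smul a)) ?_ fun k => ?_)⟩
  · rw [Pi.sub_apply, Pi.smul_apply, hΦ.state_above_zero, ← ha, smul_eq_mul, mul_one, sub_self]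
  · have hk := Submodule.subset_span (R := ℂ) (Set.mem_range_self (f := Φ) k)
    have h1 := (hx _ (hspan _ hk).1).2 (decomposableState Φ)
    rw [(hspan _ hk).2, map_zero, (hspan _ (hT _ hk)).2, add_zero] at h1
    have h2 := (smearedEnd (Φ k) (hspan _ hk).1).map_sub (x (decomposableState Φ))
      (a • decomposableState Φ)
    change psiBarSmeared _ _ = psiBarSmeared _ _ - psiBarSmeared _ _ at h2
    rw [h2, ← h1, psiBarSmeared_smul, (hspan _ hk).2, smul_zero, sub_zero]

end IsFrame

/-! ### Associativity of the product of pseudo-differential operators -/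

theorem Finset.sum_range_sum_range_eq_sum_antidiagonal {M : Type*} [AddCommMonoid M] (K : ℕ)
    (f : ℕ → ℕ → M) (hf : ∀ e v, K ≤ e + v → f e v = 0) :
    ∑ e ∈ Finset.range K, ∑ v ∈ Finset.range K, f e v =
      ∑ k ∈ Finset.range K, ∑ x ∈ Finset.HasAntidiagonal.antidiagonal k, f x.1 x.2 := by
  rw [← Finset.sum_product' (f := f)]
  rw [← Finset.sum_filter_of_ne (p := fun x : ℕ × ℕ => x.1 + x.2 < K) (fun x _ hx => by
    by_contra h
    exact hx (hf _ _ (by omega)))]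
  rw [← Finset.sum_fiberwise_of_maps_to (t := Finset.range K) (g := fun x : ℕ × ℕ => x.1 + x.2)
    (fun x hx => by
      rw [Finset.mem_filter] at hx
      exact Finset.mem_range.2 hx.2)]
  refine Finset.sum_congr rfl fun k hk => Finset.sum_congr ?_ fun _ _ => rfl
  ext x
  have := Finset.mem_range.1 hk
  simp only [Finset.mem_filter, Finset.mem_product, Finset.mem_range, Finset.HasAntidiagonal.mem_antidiagonal]
  omega

theorem Finset.sum_eq_sum_of_shift {M : Type*} [AddCommMonoid M] (s t : Finset ℤ) (f : ℤ → M)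
    (d : ℤ) (hs : ∀ l, f l ≠ 0 → l ∈ s) (ht : ∀ u, f (u + d) ≠ 0 → u ∈ t) :
    ∑ l ∈ s, f l = ∑ u ∈ t, f (u + d) := by
  rw [← finsum_eq_sum_of_support_subset f (s := s) fun l hl => hs l hl,
    ← finsum_eq_sum_of_support_subset (fun u => f (u + d)) (s := t) fun u hu => ht u hu]
  exact (finsum_comp_equiv (Equiv.addRight d) (f := f)).symm

/-! ### Iterates of a derivation -/

namespace Derivation

variable {R : Type*} [CommRing R] [Algebra ℂ R] (δ : Derivation ℂ R R)

theorem iterate_map_zero' (k : ℕ) : δ^[k] (0 : R) = 0 := iterate_map_zero δ k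

theorem iterate_sum {ι : Type*} (s : Finset ι) (f : ι → R) (k : ℕ) :
    δ^[k] (∑ i ∈ s, f i) = ∑ i ∈ s, δ^[k] (f i) := by
  induction k generalizing f with
  | zero => rfl
  | succ k ih => simp only [Function.iterate_succ_apply, map_sum, ih]

theorem iterate_zsmul (n : ℤ) (x : R) (k : ℕ) : δ^[k] (n • x) = n • δ^[k] x := by
  induction k generalizing x with
  | zero => rfl
  | succ k ih => simp only [Function.iterate_succ_apply, map_zsmul, ih]

theorem iterate_mul (x y : R) (k : ℕ) :
    δ^[k] (x * y) = ∑ a ∈ Finset.HasAntidiagonal.antidiagonal k, k.choose a.1 • (δ^[a.1] x * δ^[a.2] y) := by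
  induction k with
  | zero => simp
  | succ k ih =>
    rw [Finset.sum_antidiagonal_choose_succ_nsmul (fun i j => δ^[i] x * δ^[j] y),
      Function.iterate_succ_apply', ih, map_sum, ← Finset.sum_add_distrib]
    refine Finset.sum_congr rfl fun a ha => ?_
    have h : k.choose a.2 = k.choose a.1 := by
      rw [← Finset.HasAntidiagonal.mem_antidiagonal.1 ha, Nat.choose_symm_add]
    rw [map_nsmul, Derivation.leibniz, h, Function.iterate_succ_apply', Function.iterate_succ_apply',
      smul_eq_mul, smul_eq_mul, ← nsmul_add, mul_comm (δ^[a.2] y)]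

end Derivation

namespace PDO

section Assoc

variable {R : Type} [CommRing R] [Algebra ℂ R] (δ : Derivation ℂ R R)

/-- The coefficient of `∂^m` in `∂^i · ∑_n c_n ∂^n`. -/
noncomputable def dshift (i : ℤ) (c : ℤ → R) (m : ℤ) : R :=
  ∑ᶠ k : ℕ, Ring.choose i k • δ^[k] (c (m - i + k))

variable {δ}

/-- Leaving `K` free lets several series be truncated at one common length before they are compared.
-/
theorem dshift_eq_sum {c : ℤ → R} {N : ℤ} (hc : ∀ n, N < n → c n = 0) (i m : ℤ) (K : ℕ)
    (hK : N < m - i + K) :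
    dshift δ i c m = ∑ k ∈ Finset.range K, Ring.choose i k • δ^[k] (c (m - i + k)) := by
  refine finsum_eq_sum_of_support_subset _ fun k hk => ?_
  rw [Finset.coe_range, Set.mem_Iio]
  by_contra h
  apply hk
  show Ring.choose i k • δ^[k] (c (m - i + k)) = 0
  rw [hc _ (by omega), δ.iterate_map_zero', smul_zero]

theorem dshift_eq_zero {c : ℤ → R} {N : ℤ} (hc : ∀ n, N < n → c n = 0) (i m : ℤ)
    (hm : N + i < m) : dshift δ i c m = 0 := by
  rw [dshift_eq_sum hc i m 0 (by push_cast; omega), Finset.sum_range_zero]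

/-- This is `∂^i ∂^u = ∂^{i+u}`, that is, the Chu–Vandermonde identity for generalized binomials,
valid for negative exponents too. -/
theorem dshift_dshift {c : ℤ → R} {N : ℤ} (hc : ∀ n, N < n → c n = 0) (i u m : ℤ) :
    dshift δ i (dshift δ u c) m = dshift δ (i + u) c m := by
  have hK : N < m - i - u + ((N - m + i + u).toNat + 1 : ℕ) := by
    push_cast
    omega
  generalize (N - m + i + u).toNat + 1 = K at hK
  rw [dshift_eq_sum (N := N + u) (fun n hn => dshift_eq_zero hc u n (by omega)) i m K (by omega),
    dshift_eq_sum hc (i + u) m K (by omega)]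
  have e1 : ∀ e ∈ Finset.range K, Ring.choose i e • δ^[e] (dshift δ u c (m - i + e)) =
      ∑ v ∈ Finset.range K,
        (Ring.choose i e * Ring.choose u v) • δ^[e + v] (c (m - (i + u) + ((e + v : ℕ) : ℤ))) := by
    intro e _
    rw [dshift_eq_sum hc u _ K (by omega), δ.iterate_sum, Finset.smul_sum]
    refine Finset.sum_congr rfl fun v _ => ?_
    rw [δ.iterate_zsmul, ← Function.iterate_add_apply, smul_smul]
    congr 3
    push_cast
    ring
  rw [Finset.sum_congr rfl e1, Finset.sum_range_sum_range_eq_sum_antidiagonal]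
  · refine Finset.sum_congr rfl fun k _ => ?_
    rw [Ring.add_choose_eq k (Commute.all i u), Finset.sum_smul]
    refine Finset.sum_congr rfl fun x hx => ?_
    rw [Finset.HasAntidiagonal.mem_antidiagonal.1 hx]
  · intro e v hev
    rw [hc _ (by push_cast; omega), δ.iterate_map_zero', smul_zero]

/-- This is `∂^i (b C) = ∑_a binom(i, a) (δ^a b) ∂^{i-a} C`. It follows from the Leibniz rule and
`binom(i, k) binom(k, a) = binom(i, a) binom(i-a, k-a)`. -/
theorem dshift_mul_left {c : ℤ → R} {N : ℤ} (hc : ∀ n, N < n → c n = 0) (b : R) (i m : ℤ) (K : ℕ)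
    (hK : N < m - i + K) :
    dshift δ i (fun n => b * c n) m =
      ∑ a ∈ Finset.range K, Ring.choose i a • (δ^[a] b * dshift δ (i - a) c m) := by
  rw [dshift_eq_sum (N := N) (fun n hn => by rw [hc n hn, mul_zero]) i m K hK]
  have e1 : ∀ a ∈ Finset.range K, Ring.choose i a • (δ^[a] b * dshift δ (i - a) c m) =
      ∑ e ∈ Finset.range K, (Ring.choose i a * Ring.choose (i - a) e) •
        (δ^[a] b * δ^[e] (c (m - i + ((a + e : ℕ) : ℤ)))) := by
    intro a _
    rw [dshift_eq_sum hc (i - a) _ K (by omega), Finset.mul_sum, Finset.smul_sum]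
    refine Finset.sum_congr rfl fun e _ => ?_
    rw [mul_smul_comm, smul_smul]
    congr 4
    push_cast
    ring
  rw [Finset.sum_congr rfl e1, Finset.sum_range_sum_range_eq_sum_antidiagonal]
  · refine Finset.sum_congr rfl fun k _ => ?_
    rw [δ.iterate_mul, Finset.smul_sum]
    refine Finset.sum_congr rfl fun x hx => ?_
    have hx' := Finset.HasAntidiagonal.mem_antidiagonal.1 hx
    have h := Ring.choose_smul_choose i (n := k) (k := x.1) (by omega)
    rw [show k - x.1 = x.2 by omega] at h
    rw [hx', ← h, smul_comm, ← smul_assoc]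
  · intro a e hae
    rw [hc _ (by push_cast; omega), δ.iterate_map_zero', mul_zero, smul_zero]

theorem dshift_sum {ι : Type*} (s : Finset ι) {c : ι → ℤ → R} {N : ℤ}
    (hc : ∀ u ∈ s, ∀ n, N < n → c u n = 0) (i m : ℤ) :
    dshift δ i (fun n => ∑ u ∈ s, c u n) m = ∑ u ∈ s, dshift δ i (c u) m := by
  have hK : N < m - i + ((N - m + i).toNat + 1 : ℕ) := by
    push_cast
    omega
  generalize (N - m + i).toNat + 1 = K at hK
  rw [dshift_eq_sum (N := N) (fun n hn => Finset.sum_eq_zero fun u hu => hc u hu n hn) i m K hK,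
    Finset.sum_congr rfl fun u hu => dshift_eq_sum (hc u hu) i m K hK, Finset.sum_comm]
  refine Finset.sum_congr rfl fun k _ => ?_
  rw [δ.iterate_sum, Finset.smul_sum]

theorem dshift_congr {c c' : ℤ → R} (i m : ℤ) (h : ∀ n, m - i ≤ n → c n = c' n) :
    dshift δ i c m = dshift δ i c' m :=
  finsum_congr fun k => by rw [h _ (by omega)]

theorem mul_coeff_eq_sum {A B : PDO R} {N M : ℤ} (hA : ∀ n, N < n → A.coeff n = 0)
    (hB : ∀ n, M < n → B.coeff n = 0) (m : ℤ) (s : Finset ℤ) (hs : Finset.Icc (m - M) N ⊆ s) :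
    (mul δ A B).coeff m = ∑ i ∈ s, A.coeff i * dshift δ i B.coeff m := by
  have hterm : ∀ i ∈ s, A.coeff i * dshift δ i B.coeff m =
      ∑ k ∈ Finset.range (N + M - m + 1).toNat, Ring.choose i k •
        (A.coeff i * δ^[k] (B.coeff (m - i + k))) := by
    intro i _
    by_cases hi : N < i
    · simp [hA i hi]
    · rw [dshift_eq_sum hB i m (N + M - m + 1).toNat (by omega), Finset.mul_sum]
      exact Finset.sum_congr rfl fun k _ => mul_smul_comm _ _ _
  rw [Finset.sum_congr rfl hterm, ← Finset.sum_product']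
  refine finsum_eq_sum_of_support_subset _ ?_
  rintro ⟨i, k⟩ hik
  have hi : i ≤ N := by
    by_contra h
    exact hik (by simp [hA i (by omega)])
  have hk : m - i + k ≤ M := by
    by_contra h
    exact hik (by simp [hB (m - i + k) (by omega), δ.iterate_map_zero'])
  simp only [Finset.coe_product, Set.mem_prod, Finset.mem_coe]
  exact ⟨hs (Finset.mem_Icc.2 ⟨by omega, hi⟩), Finset.mem_range.2 (by omega)⟩

theorem mul_coeff_eq_zero {A B : PDO R} {N M : ℤ} (hA : ∀ n, N < n → A.coeff n = 0)
    (hB : ∀ n, M < n → B.coeff n = 0) (m : ℤ) (hm : N + M < m) : (mul δ A B).coeff m = 0 := by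
  rw [mul_coeff_eq_sum hA hB m ∅, Finset.sum_empty]
  rw [Finset.Icc_eq_empty (by omega)]

/-- By `dshift_mul_left` and `dshift_dshift`, both sides become triple sums of `binom(i, a) A_i (δ^a
B_u) ∂^{u+i-a} C`; only the choice of summation index differs. -/
theorem mul_assoc (A B C : PDO R) : mul δ (mul δ A B) C = mul δ A (mul δ B C) := by
  obtain ⟨N, hA⟩ := A.bdd
  obtain ⟨M, hB⟩ := B.bdd
  obtain ⟨P, hC⟩ := C.bdd
  ext m
  have hK : N + M + P < m + ((N + M + P - m).toNat + 1 : ℕ) := by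
    push_cast
    omega
  generalize (N + M + P - m).toNat + 1 = K at hK
  set I := Finset.Icc (m - P - M) N with hI
  set L := Finset.Icc (m - P) (N + M) with hL
  set U := Finset.Icc (m - P - N) M with hU
  have h1 : (mul δ (mul δ A B) C).coeff m = ∑ l ∈ L, ∑ i ∈ I, ∑ a ∈ Finset.range K,
      Ring.choose i a • (A.coeff i * δ^[a] (B.coeff (l - i + a)) * dshift δ l C.coeff m) := by
    rw [mul_coeff_eq_sum (N := N + M) (fun n hn => mul_coeff_eq_zero hA hB n hn) hC m L
      (Finset.Subset.refl _)]
    refine Finset.sum_congr rfl fun l hl => ?_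
    have hl := Finset.mem_Icc.1 hl
    rw [mul_coeff_eq_sum hA hB l I (Finset.Icc_subset_Icc_left (by omega)), Finset.sum_mul]
    refine Finset.sum_congr rfl fun i hi => ?_
    have hi := Finset.mem_Icc.1 hi
    rw [dshift_eq_sum hB i l K (by omega), Finset.mul_sum, Finset.sum_mul]
    refine Finset.sum_congr rfl fun a _ => ?_
    rw [mul_smul_comm, smul_mul_assoc]
  have h2 : (mul δ A (mul δ B C)).coeff m = ∑ i ∈ I, ∑ u ∈ U, ∑ a ∈ Finset.range K,
      Ring.choose i a • (A.coeff i * δ^[a] (B.coeff u) * dshift δ (u + (i - a)) C.coeff m) := by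
    rw [mul_coeff_eq_sum (M := M + P) hA (fun n hn => mul_coeff_eq_zero hB hC n hn) m I
      (Finset.Icc_subset_Icc_left (by omega))]
    refine Finset.sum_congr rfl fun i hi => ?_
    have hi := Finset.mem_Icc.1 hi
    have e : dshift δ i (mul δ B C).coeff m =
        dshift δ i (fun n => ∑ u ∈ U, B.coeff u * dshift δ u C.coeff n) m :=
      dshift_congr i m fun n hn =>
        mul_coeff_eq_sum hB hC n U (Finset.Icc_subset_Icc_left (by omega))
    rw [e, dshift_sum (N := M + P) U, Finset.mul_sum]
    · refine Finset.sum_congr rfl fun u hu => ?_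
      have hu := Finset.mem_Icc.1 hu
      rw [dshift_mul_left (N := P + u) (fun n hn => dshift_eq_zero hC u n (by omega)) _ i m K
        (by omega), Finset.mul_sum]
      refine Finset.sum_congr rfl fun a _ => ?_
      rw [mul_smul_comm, dshift_dshift hC, _root_.mul_assoc, add_comm u]
    · intro u hu n hn
      have hu := Finset.mem_Icc.1 hu
      rw [dshift_eq_zero hC u n (by omega), mul_zero]
  rw [h1, h2, Finset.sum_comm]
  refine Finset.sum_congr rfl fun i hi => ?_
  have hi := Finset.mem_Icc.1 hi
  rw [Finset.sum_comm, Finset.sum_comm (s := U)]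
  refine Finset.sum_congr rfl fun a _ => ?_
  have hne : ∀ l, Ring.choose i a •
      (A.coeff i * δ^[a] (B.coeff (l - i + a)) * dshift δ l C.coeff m) ≠ 0 →
      l - i + a ≤ M ∧ m - P ≤ l := by
    intro l hl
    constructor
    · by_contra h
      exact hl (by rw [hB _ (by omega), δ.iterate_map_zero', mul_zero, zero_mul, smul_zero])
    · by_contra h
      exact hl (by rw [dshift_eq_zero hC l m (by omega), mul_zero, smul_zero])
  -- The left side is indexed by the order `l = u + i - a` of the term of `A B`, the right side by
  -- the order `u` in `B`.
  rw [Finset.sum_eq_sum_of_shift L U _ (i - a)]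
  · refine Finset.sum_congr rfl fun u _ => ?_
    congr 4
    congr 2
    ring
  · intro l hl
    have := hne l hl
    exact Finset.mem_Icc.2 ⟨by omega, by omega⟩
  · intro u hu
    have := hne _ hu
    exact Finset.mem_Icc.2 ⟨by omega, by omega⟩

end Assoc

end PDO

/-! ### Products with powers of `∂` and with differential operators -/

namespace PDO

theorem dpow_coeff_bound {R : Type} [CommRing R] (n : ℤ) : ∀ m, n < m → (dpow R n).coeff m = 0 :=
  fun _ hm => if_neg hm.ne'

section Products

variable {R : Type} [CommRing R] [Algebra ℂ R] {δ : Derivation ℂ R R}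

theorem dpow_mul_coeff (i : ℤ) (B : PDO R) (m : ℤ) :
    (mul δ (dpow R i) B).coeff m = dshift δ i B.coeff m := by
  obtain ⟨M, hB⟩ := B.bdd
  rw [mul_coeff_eq_sum (dpow_coeff_bound i) hB m (Finset.Icc (m - M) i ∪ {i})
    Finset.subset_union_left, Finset.sum_eq_single i]
  · simp [dpow]
  · intro j _ hj
    simp [dpow, hj]
  · intro h
    exact absurd (Finset.mem_union_right _ (Finset.mem_singleton_self i)) h

theorem dshift_dpow (n i m : ℤ) :
    dshift δ i (dpow R n).coeff m = if m - i = n then 1 else 0 := by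
  rw [dshift, finsum_eq_single _ 0]
  · simp [dpow]
  · intro k hk
    obtain ⟨k, rfl⟩ := Nat.exists_eq_succ_of_ne_zero hk
    have : δ (if m - i + ((k + 1 : ℕ) : ℤ) = n then (1 : R) else 0) = 0 := by
      split_ifs <;> simp
    simp only [dpow, Nat.succ_eq_add_one, Function.iterate_succ_apply]
    rw [this, δ.iterate_map_zero', smul_zero]

theorem mul_dpow_coeff (B : PDO R) (n m : ℤ) :
    (mul δ B (dpow R n)).coeff m = B.coeff (m - n) := by
  obtain ⟨N, hB⟩ := B.bdd
  rw [mul_coeff_eq_sum hB (dpow_coeff_bound n) m (Finset.Icc (m - n) N ∪ {m - n})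
    Finset.subset_union_left, Finset.sum_eq_single (m - n)]
  · rw [dshift_dpow, if_pos (by ring), mul_one]
  · intro j _ hj
    rw [dshift_dpow, if_neg (by omega), mul_zero]
  · intro h
    exact absurd (Finset.mem_union_right _ (Finset.mem_singleton_self _)) h

theorem mul_one_right (B : PDO R) : mul δ B (one R) = B := by
  ext m
  rw [one, mul_dpow_coeff, sub_zero]

/-- A negative order could arise only after more than `k` derivatives, where `binom(k, j)` vanishes.
-/
theorem IsDifferential.dpow_mul {A : PDO R} (hA : A.IsDifferential) (k : ℕ) :
    (mul δ (dpow R k) A).IsDifferential := by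
  intro m hm
  rw [dpow_mul_coeff, dshift, finsum_eq_zero_of_forall_eq_zero]
  intro j
  by_cases hj : m - k + j < 0
  · rw [hA _ hj, δ.iterate_map_zero', smul_zero]
  · rw [Ring.choose_natCast, Nat.choose_eq_zero_of_lt (by omega), Nat.cast_zero, zero_smul]

/-- Coefficients stand on the left, so `A B` is a combination of the `∂^k B` without derivatives of
`A`. One length `N` serves all `m`, as membership in a span requires. -/
theorem IsDifferential.mul_coeff {A : PDO R} (hA : A.IsDifferential) (B : PDO R) :
    ∃ N : ℕ, ∀ m, (mul δ A B).coeff m =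
      ∑ k ∈ Finset.range N, A.coeff k * (mul δ (dpow R k) B).coeff m := by
  obtain ⟨N, hN⟩ := A.bdd
  obtain ⟨M, hB⟩ := B.bdd
  refine ⟨(N + 1).toNat, fun m => ?_⟩
  have hinj : ∑ k ∈ Finset.range (N + 1).toNat, A.coeff k * (mul δ (dpow R k) B).coeff m =
      ∑ i ∈ (Finset.range (N + 1).toNat).map Nat.castEmbedding,
        A.coeff i * dshift δ i B.coeff m := by
    rw [Finset.sum_map]
    simp only [dpow_mul_coeff, Nat.castEmbedding_apply]
  rw [hinj, mul_coeff_eq_sum hN hB m (Finset.Icc (m - M) N ∪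
    (Finset.range (N + 1).toNat).map Nat.castEmbedding) Finset.subset_union_left]
  symm
  refine Finset.sum_subset Finset.subset_union_right fun i hi hi' => ?_
  by_cases h0 : i < 0
  · rw [hA i h0, zero_mul]
  · by_cases h1 : N < i
    · rw [hN i h1, zero_mul]
    · refine absurd (Finset.mem_map.2 ⟨i.toNat, ?_, ?_⟩) hi'
      · exact Finset.mem_range.2 (by omega)
      · rw [Nat.castEmbedding_apply]
        omega

end Products

end PDO

/-! ### The point of the Grassmannian and its Kac–Schwarz operators -/

section KacSchwarz

variable {N : ℕ}

theorem isFrame_satoFrame (hN : 0 < N) (g : ℂ) {W : PDO (Fun N)} (hW : IsSatoOperator W) :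
    IsFrame (satoFrame hN g W) :=
  ⟨fun k => (satoFrame_leading hN g hW k).1, fun k => (satoFrame_leading hN g hW k).2⟩

/-- The symbol of `D W` at the background lies in the span of the frame, for `D` a differential
operator. -/
theorem symbol_mem_span (hN : 0 < N) (g : ℂ) (W : PDO (Fun N)) {D : PDO (Fun N)}
    (hD : D.IsDifferential) :
    (fun m => atBackground ((PDO.mul (delta hN g) D W).coeff m)) ∈
      Submodule.span ℂ (Set.range (satoFrame hN g W)) := by
  obtain ⟨M, hM⟩ := hD.mul_coeff (δ := delta hN g) W
  have e : (fun m => atBackground ((PDO.mul (delta hN g) D W).coeff m)) =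
      ∑ k ∈ Finset.range M, atBackground (D.coeff k) • satoFrame hN g W k := by
    funext m
    rw [hM, Finset.sum_apply]
    simp only [atBackground, map_sum, map_mul]
    rfl
  rw [e]
  exact Submodule.sum_mem _ fun k _ =>
    Submodule.smul_mem _ _ (Submodule.subset_span (Set.mem_range_self k))

/-- Right multiplication by an operator `S` for which `W S W⁻¹` is a differential operator maps
the frame into its span. -/
theorem frame_mul_mem_span (hN : 0 < N) (g : ℂ) {W Winv S : PDO (Fun N)}
    (hinv : PDO.mul (delta hN g) Winv W = PDO.one (Fun N))
    (hS : (PDO.mul (delta hN g) (PDO.mul (delta hN g) W S) Winv).IsDifferential) (k : ℕ) :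
    (fun m => atBackground ((PDO.mul (delta hN g)
      (PDO.mul (delta hN g) (PDO.dpow (Fun N) k) W) S).coeff m)) ∈
      Submodule.span ℂ (Set.range (satoFrame hN g W)) := by
  -- Insert `W⁻¹ W` on the right: `∂^k W S = (∂^k · W S W⁻¹) W`.
  have e : PDO.mul (delta hN g) (PDO.mul (delta hN g) (PDO.dpow (Fun N) k) W) S =
      PDO.mul (delta hN g) (PDO.mul (delta hN g) (PDO.dpow (Fun N) k)
        (PDO.mul (delta hN g) (PDO.mul (delta hN g) W S) Winv)) W := by
    rw [PDO.mul_assoc, PDO.mul_assoc (PDO.dpow (Fun N) k), PDO.mul_assoc _ Winv W, hinv,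
      PDO.mul_one_right]
  rw [e]
  exact symbol_mem_span hN g W (hS.dpow_mul k)

theorem delta_xVar (hN : 0 < N) (g : ℂ) (b : Fin N → ℂ) (i : Fin N) :
    delta hN g (xVar b i) = if i = ⟨0, hN⟩ then MvPowerSeries.C g else 0 := by
  rw [delta, Derivation.smul_apply, partialX, xVar, map_add, MvPowerSeries.pderiv_C, zero_add]
  split_ifs with h
  · rw [h, MvPowerSeries.pderiv_X_self, MvPowerSeries.smul_eq_C_mul, mul_one]
  · rw [MvPowerSeries.pderiv_X_of_ne h, smul_zero]

theorem delta_C (hN : 0 < N) (g a : ℂ) : delta hN g (MvPowerSeries.C a) = 0 := by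
  rw [delta, Derivation.smul_apply, partialX, MvPowerSeries.pderiv_C, smul_zero]

theorem delta_stringOp (hN : 0 < N) (p : ℕ) (g γ : ℂ) (b : Fin N → ℂ) (j : ℤ) :
    delta hN g ((stringOp p g γ b).coeff j) =
      if j = 1 - (p : ℤ) then MvPowerSeries.C g else 0 := by
  have h2 : delta hN g (if j = -(p : ℤ) then MvPowerSeries.C (g * γ) else 0) = 0 := by
    split_ifs
    · exact delta_C hN g _
    · exact map_zero _
  simp only [stringOp, map_add, map_sum, h2, add_zero]
  rw [Finset.sum_eq_single ⟨0, hN⟩]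
  · simp only [Nat.cast_zero, zero_add]
    split_ifs
    · rw [Derivation.map_smul, delta_xVar, if_pos rfl, one_smul]
    · exact map_zero _
  · intro i _ hi
    split_ifs
    · rw [Derivation.map_smul, delta_xVar, if_neg hi, smul_zero]
    · exact map_zero _
  · exact fun h => absurd (Finset.mem_univ _) h

/-- The string operator is affine in `x` and `∂` sees only `x_1`, so the expansion of `∂^i` past its
coefficients stops after one derivative. -/
theorem dshift_stringOp (hN : 0 < N) (p : ℕ) (g γ : ℂ) (b : Fin N → ℂ) (i m : ℤ) :
    PDO.dshift (delta hN g) i (stringOp p g γ b).coeff m =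
      (stringOp p g γ b).coeff (m - i) +
        i • (if m - i + 1 = 1 - (p : ℤ) then MvPowerSeries.C g else 0) := by
  rw [PDO.dshift, finsum_eq_sum_of_support_subset (s := Finset.range 2)]
  · rw [Finset.sum_range_succ, Finset.sum_range_one, Ring.choose_zero_right, one_smul,
      Ring.choose_one_right]
    simp only [Function.iterate_zero, id, Function.iterate_one, delta_stringOp, Nat.cast_zero,
      add_zero, Nat.cast_one]
  · intro k hk
    by_contra hk2
    rw [Finset.mem_coe, Finset.mem_range, not_lt] at hk2
    obtain ⟨l, rfl⟩ := Nat.exists_eq_add_of_le' hk2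
    have h2 : delta hN g (if m - i + ((l + 2 : ℕ) : ℤ) = 1 - (p : ℤ) then MvPowerSeries.C g
        else 0) = 0 := by
      split_ifs
      · exact delta_C hN g _
      · exact map_zero _
    refine hk ?_
    simp only
    rw [Function.iterate_add_apply, Function.iterate_succ_apply, Function.iterate_one,
      delta_stringOp, h2, (delta hN g).iterate_map_zero', smul_zero]

theorem atBackground_stringOp (p : ℕ) (g γ : ℂ) (b : Fin N → ℂ) (j : ℤ) :
    atBackground ((stringOp p g γ b).coeff j) =
      (∑ i : Fin N, if j = (i : ℤ) + 1 - p then ((i : ℂ) + 1) * b i else 0) +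
        if j = -(p : ℤ) then g * γ else 0 := by
  simp only [stringOp, atBackground, map_add, map_sum]
  congr 1
  · refine Finset.sum_congr rfl fun i _ => ?_
    split_ifs
    · simp [xVar]
    · simp
  · split_ifs <;> simp

/-- Derivatives fall only on the string operator, so the coefficients of `B` enter through their
values at `b`. Commuting past `x_1` yields `g λ^{1-p} ∂_λ`, which is where the factor `m + p` comes
from. -/
theorem mul_stringOp_symbol (hN : 0 < N) (p : ℕ) (g γ : ℂ) (b : Fin N → ℂ) (B : PDO (Fun N))
    (m : ℤ) :
    atBackground ((PDO.mul (delta hN g) B (stringOp p g γ b)).coeff m) =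
      (∑ i : Fin N, ((i : ℂ) + 1) * b i * atBackground (B.coeff (m - ((i : ℤ) + 1 - p)))) +
        g * (γ + (m + p : ℤ)) * atBackground (B.coeff (m + p)) := by
  obtain ⟨M, hB⟩ := B.bdd
  obtain ⟨P, hS⟩ := (stringOp p g γ b).bdd
  set s := Finset.Icc (m - P) M ∪ (insert (m + p : ℤ)
    (Finset.univ.image fun i : Fin N => m - ((i : ℤ) + 1 - p))) with hs
  have hmem0 : (m + p : ℤ) ∈ s :=
    Finset.mem_union_right _ (Finset.mem_insert_self _ _)
  have hmem : ∀ i : Fin N, m - ((i : ℤ) + 1 - p) ∈ s := fun i =>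
    Finset.mem_union_right _ (Finset.mem_insert_of_mem
      (Finset.mem_image_of_mem _ (Finset.mem_univ i)))
  rw [PDO.mul_coeff_eq_sum hB hS m s Finset.subset_union_left]
  have hterm : ∀ j ∈ s, atBackground (B.coeff j * PDO.dshift (delta hN g) j
      (stringOp p g γ b).coeff m) =
      (∑ i : Fin N, if j = m - ((i : ℤ) + 1 - p) then
        ((i : ℂ) + 1) * b i * atBackground (B.coeff j) else 0) +
      if j = m + p then g * (γ + (m + p : ℤ)) * atBackground (B.coeff j) else 0 := by
    intro j _
    have h0 := atBackground_stringOp p g γ b (m - j)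
    rw [dshift_stringOp]
    simp only [atBackground, map_mul, map_add, map_zsmul] at h0 ⊢
    rw [h0, mul_add, mul_add, Finset.mul_sum, add_assoc]
    congr 1
    · refine Finset.sum_congr rfl fun i _ => ?_
      by_cases hi : j = m - ((i : ℤ) + 1 - p)
      · rw [if_pos hi, if_pos (by omega)]
        ring
      · rw [if_neg hi, if_neg (by omega), mul_zero]
    · by_cases hj : j = m + p
      · rw [if_pos hj, if_pos (by omega), if_pos (by omega), MvPowerSeries.constantCoeff_C, hj,
          zsmul_eq_mul]
        ring
      · rw [if_neg hj, if_neg (by omega), if_neg (by omega)]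
        simp
  have hsum : atBackground (∑ j ∈ s, B.coeff j * PDO.dshift (delta hN g) j
      (stringOp p g γ b).coeff m) = ∑ j ∈ s, atBackground (B.coeff j * PDO.dshift (delta hN g) j
      (stringOp p g γ b).coeff m) := map_sum _ _ _
  rw [hsum, Finset.sum_congr rfl hterm, Finset.sum_add_distrib, Finset.sum_comm,
    Finset.sum_ite_eq' s (m + p : ℤ), if_pos hmem0]
  congr 1
  refine Finset.sum_congr rfl fun i _ => ?_
  rw [Finset.sum_ite_eq' s, if_pos (hmem i)]

end KacSchwarz

/-! ### The zero-point constant -/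

theorem descPochhammer_eval_eq_choose (r : ℂ) (n : ℕ) :
    (descPochhammer ℂ n).eval r = n.factorial * Ring.choose r n := by
  have h := Ring.descPochhammer_eq_factorial_smul_choose r n
  rw [← Polynomial.aeval_eq_smeval, nsmul_eq_mul] at h
  rw [← h, ← descPochhammer_map (algebraMap ℤ ℂ), Polynomial.eval_map_algebraMap]

theorem twistedExponent_add {p : ℕ} (hp : 0 < p) (k n : ℤ) :
    twistedExponent p (k + n) = twistedExponent p k + n / p := by
  have : (p : ℂ) ≠ 0 := by exact_mod_cast hp.ne'
  rw [twistedExponent, twistedExponent]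
  push_cast
  field_simp
  ring

/-- The powers `(1+t)^{ν_k}`, `0 ≤ k < p`, form a geometric progression of ratio `(1+t)^{1/p}`. The
sum telescopes to `(1+t)^{ν_p} - (1+t)^{ν_0}` with `ν_p = ν_0 + 1`. -/
theorem sum_binomialSeries_mul {p : ℕ} (hp : 0 < p) :
    (∑ k ∈ Finset.range p, PowerSeries.binomialSeries ℂ (twistedExponent p k)) *
      (PowerSeries.binomialSeries ℂ (1 / (p : ℂ)) - 1) =
      PowerSeries.X * PowerSeries.binomialSeries ℂ ((1 - (p : ℂ)) / (2 * p)) := by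
  have hp' : (p : ℂ) ≠ 0 := by exact_mod_cast hp.ne'
  have hstep : ∀ k ∈ Finset.range p, PowerSeries.binomialSeries ℂ (twistedExponent p k) *
      (PowerSeries.binomialSeries ℂ (1 / (p : ℂ)) - 1) =
      PowerSeries.binomialSeries ℂ (twistedExponent p ((k + 1 : ℕ) : ℤ)) -
        PowerSeries.binomialSeries ℂ (twistedExponent p k) := by
    intro k _
    rw [mul_sub, mul_one, ← PowerSeries.binomialSeries_add]
    congr 2
    rw [Nat.cast_succ, twistedExponent_add hp, Int.cast_one]
  rw [Finset.sum_mul, Finset.sum_congr rfl hstep,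
    Finset.sum_range_sub (fun k : ℕ => PowerSeries.binomialSeries ℂ (twistedExponent p k))]
  have h0 : twistedExponent p ((0 : ℕ) : ℤ) = (1 - (p : ℂ)) / (2 * p) := by
    simp [twistedExponent]
  have h1 : twistedExponent p (p : ℤ) = (1 - (p : ℂ)) / (2 * p) + ((1 : ℕ) : ℂ) := by
    have := twistedExponent_add hp 0 p
    rw [zero_add] at this
    rw [this, ← h0, Int.cast_natCast, div_self hp', Nat.cast_zero, Nat.cast_one]
  rw [h0, h1, PowerSeries.binomialSeries_add, PowerSeries.binomialSeries_nat, pow_one]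
  ring

/-- The geometric sum turns the contraction difference into `t⁻¹ ((1/p) ∑ (1+t)^{ν_k} - 1)` in the
expansion variable `t`, whose coefficients are binomials. The result has the shape of the central
term in `alpha_bilinear`. -/
theorem zeroPoint_eq_sum {p : ℕ} (hp : 0 < p) (t : ℕ) :
    zeroPoint p (t + 1) =
      ∑ k ∈ Finset.range p, (descPochhammer ℂ (t + 1)).eval (twistedExponent p k) := by
  have hp' : (p : ℂ) ≠ 0 := by exact_mod_cast hp.ne'
  have hne : PowerSeries.binomialSeries ℂ (1 / (p : ℂ)) - 1 ≠ 0 := by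
    intro h
    have := congrArg (PowerSeries.coeff 1) h
    simp [PowerSeries.coeff_one, hp'] at this
  set G := ∑ k ∈ Finset.range p, PowerSeries.binomialSeries ℂ (twistedExponent p k) with hG
  have hdiv : contractionDifference p = HahnSeries.single (-1) 1 *
      HahnSeries.ofPowerSeries ℤ ℂ ((1 / (p : ℂ)) • G) - HahnSeries.single (-1) 1 := by
    rw [contractionDifference]
    congr 1
    rw [div_eq_iff, mul_assoc, ← map_mul, smul_mul_assoc, hG, sum_binomialSeries_mul hp,
      ← mul_smul_comm, map_mul, ← mul_assoc, HahnSeries.ofPowerSeries_X,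
      HahnSeries.single_mul_single]
    · simp
    · rw [Ne, map_eq_zero_iff _ HahnSeries.ofPowerSeries_injective]
      exact hne
  have hc : (contractionDifference p).coeff (((t + 1 : ℕ) : ℤ) - 1) =
      (1 / (p : ℂ)) * ∑ k ∈ Finset.range p, Ring.choose (twistedExponent p k) (t + 1) := by
    rw [hdiv, HahnSeries.coeff_sub, HahnSeries.coeff_single_mul, HahnSeries.coeff_single_of_ne,
      sub_zero, one_mul, sub_neg_eq_add, sub_add_cancel, HahnSeries.ofPowerSeries_apply_coeff]
    · simp [hG, map_sum]
    · push_cast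
      omega
  rw [zeroPoint, hc]
  simp only [descPochhammer_eval_eq_choose]
  rw [← Finset.mul_sum, Nat.factorial_succ, Nat.add_sub_cancel]
  field_simp
  push_cast
  ring

/-! ### Termination of the adjoint series -/

/-- The span of `1` and of the bilinears whose coefficients are polynomials of degree `< d`. -/
noncomputable def polynomialOps (d : ℕ) : Submodule ℂ (Module.End ℂ Fock) :=
  Submodule.span ℂ (insert 1 {x | ∃ P ∈ Polynomial.degreeLT ℂ d, ∃ m : ℤ,
    x = bilinear (fun k => P.eval (k : ℂ)) m})

theorem bilinear_smul (a : ℂ) (c : ℤ → ℂ) (m : ℤ) :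
    bilinear (fun k => a * c k) m = a • bilinear c m := by
  refine LinearMap.ext fun v => funext fun S => ?_
  show ∑ᶠ k : ℤ, a * c k * normalOrdered k (k + m) v S =
    a • ∑ᶠ k : ℤ, c k * normalOrdered k (k + m) v S
  rw [smul_finsum]
  simp only [smul_eq_mul, mul_assoc]

theorem bilinear_zero (m : ℤ) : bilinear (fun _ => 0) m = 0 := by
  have := bilinear_smul 0 (fun _ => 0) m
  rwa [zero_smul, show (fun _ : ℤ => (0 : ℂ) * 0) = fun _ => 0 from funext fun _ => mul_zero 0]
    at this

theorem taylor_sub_mem_degreeLT {d : ℕ} {P : Polynomial ℂ}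
    (hP : P ∈ Polynomial.degreeLT ℂ (d + 1)) (r : ℂ) :
    Polynomial.taylor r P - P ∈ Polynomial.degreeLT ℂ d := by
  rw [Polynomial.mem_degreeLT] at hP ⊢
  by_cases h0 : P = 0
  · simp [h0]
  · have h1 := Polynomial.degree_sub_lt_right (p := Polynomial.taylor r P) (q := P)
      (Polynomial.degree_taylor P r) h0 (Polynomial.leadingCoeff_taylor r P)
    rw [Polynomial.degree_eq_natDegree h0] at hP h1
    have hd : P.natDegree ≤ d := by
      have : P.natDegree < d + 1 := by exact_mod_cast hP
      omega
    exact lt_of_lt_of_le h1 (by exact_mod_cast hd)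

/-- The commutator with `a`, as a linear map. -/
def commutatorMap (a : Module.End ℂ Fock) : Module.End ℂ (Module.End ℂ Fock) :=
  LinearMap.mulLeft ℂ a - LinearMap.mulRight ℂ a

theorem commutatorMap_apply (a x : Module.End ℂ Fock) : commutatorMap a x = a * x - x * a := rfl

theorem commutatorMap_one (a : Module.End ℂ Fock) : commutatorMap a 1 = 0 := by
  rw [commutatorMap_apply, mul_one, one_mul, sub_self]

/-- The commutator replaces the coefficient `P(k)` by `P(k + n) - P(k)`, which lowers the degree;
the central term is absorbed by the unit in the span. -/
theorem commutatorMap_alpha_mem {n : ℕ} (hn : 0 < n) {d : ℕ} {x : Module.End ℂ Fock}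
    (hx : x ∈ polynomialOps (d + 1)) : commutatorMap (alpha n) x ∈ polynomialOps d := by
  have h1 : (1 : Module.End ℂ Fock) ∈ polynomialOps d :=
    Submodule.subset_span (Set.mem_insert _ _)
  induction hx using Submodule.span_induction with
  | mem x hx =>
    rcases hx with rfl | ⟨P, hP, m, rfl⟩
    · rw [commutatorMap_one]
      exact Submodule.zero_mem _
    · rw [commutatorMap_apply, alpha_bilinear hn]
      refine Submodule.add_mem _ (Submodule.subset_span (Set.mem_insert_of_mem _
        ⟨_, taylor_sub_mem_degreeLT hP (n : ℂ), m + n, ?_⟩)) (Submodule.smul_mem _ _ h1)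
      congr 1
      funext k
      rw [Polynomial.eval_sub, Polynomial.taylor_eval]
      push_cast
      rfl
  | zero =>
    rw [map_zero]
    exact Submodule.zero_mem _
  | add x y _ _ hx hy =>
    rw [map_add]
    exact Submodule.add_mem _ hx hy
  | smul a x _ hx =>
    rw [map_smul]
    exact Submodule.smul_mem _ _ hx

theorem commutatorMap_eq_zero (a : Module.End ℂ Fock) {x : Module.End ℂ Fock}
    (hx : x ∈ polynomialOps 0) : commutatorMap a x = 0 := by
  induction hx using Submodule.span_induction with
  | mem x hx =>
    rcases hx with rfl | ⟨P, hP, m, rfl⟩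
    · exact commutatorMap_one a
    · have hP0 : P = 0 := by
        rw [Polynomial.mem_degreeLT] at hP
        by_contra h
        rw [Polynomial.degree_eq_natDegree h] at hP
        exact absurd (by exact_mod_cast hP : P.natDegree < 0) (Nat.not_lt_zero _)
      simp only [hP0, Polynomial.eval_zero, bilinear_zero, map_zero]
  | zero => exact map_zero _
  | add x y _ _ hx hy => rw [map_add, hx, hy, add_zero]
  | smul c x _ hx => rw [map_smul, hx, smul_zero]

theorem commutatorMap_evolutionGenerator {N : ℕ} (g : ℂ) (b : Fin N → ℂ)
    (x : Module.End ℂ Fock) :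
    commutatorMap (evolutionGenerator g b) x =
      ∑ i : Fin N, (b i / g) • commutatorMap (alpha ((i + 1 : ℕ) : ℤ)) x := by
  simp only [commutatorMap_apply, evolutionGenerator, Finset.sum_mul, Finset.mul_sum,
    smul_mul_assoc, mul_smul_comm, smul_sub, Finset.sum_sub_distrib]
  push_cast
  rfl

theorem iteratedAd_eq_iterate (a x : Module.End ℂ Fock) (j : ℕ) :
    iteratedAd a x j = (commutatorMap a)^[j] x := rfl

/-- After `d` commutators only scalars remain, and one more kills them. -/
theorem iteratedAd_eq_zero {N : ℕ} (g : ℂ) (b : Fin N → ℂ) {d : ℕ} {x : Module.End ℂ Fock}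
    (hx : x ∈ polynomialOps d) {j : ℕ} (hj : d + 1 ≤ j) :
    iteratedAd (evolutionGenerator g b) x j = 0 := by
  obtain ⟨i, rfl⟩ := Nat.exists_eq_add_of_le' hj
  rw [iteratedAd_eq_iterate, Function.iterate_add_apply]
  have key : (commutatorMap (evolutionGenerator g b))^[d + 1] x = 0 := by
    clear hj
    induction d generalizing x with
    | zero => exact commutatorMap_eq_zero _ hx
    | succ d ih =>
      rw [Function.iterate_succ_apply]
      apply ih
      rw [commutatorMap_evolutionGenerator]
      exact Submodule.sum_mem _ fun k _ => Submodule.smul_mem _ _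
        (commutatorMap_alpha_mem (Nat.succ_pos _) hx)
  rw [key, iterate_map_zero]

/-- The coefficients of the generators are polynomial. -/
theorem bilinear_descPochhammer_mem (p s : ℕ) (m : ℤ) :
    bilinear (fun k => (descPochhammer ℂ s).eval (twistedExponent p k)) m ∈
      polynomialOps (s + 1) := by
  refine Submodule.subset_span (Set.mem_insert_of_mem _ ⟨(descPochhammer ℂ s).comp
    (Polynomial.C (1 / (p : ℂ)) * Polynomial.X + Polynomial.C ((1 - (p : ℂ)) / (2 * p))), ?_, m, ?_⟩)
  · rw [Polynomial.mem_degreeLT]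
    refine lt_of_le_of_lt Polynomial.degree_le_natDegree ?_
    have h1 : ((descPochhammer ℂ s).comp (Polynomial.C (1 / (p : ℂ)) * Polynomial.X +
        Polynomial.C ((1 - (p : ℂ)) / (2 * p)))).natDegree ≤ s * 1 := by
      refine Polynomial.natDegree_comp_le.trans ?_
      rw [descPochhammer_natDegree]
      exact Nat.mul_le_mul_left _ Polynomial.natDegree_linear_le
    rw [mul_one] at h1
    exact WithBot.coe_lt_coe.2 (Nat.lt_succ_of_le h1)
  · congr 1
    funext k
    rw [Polynomial.eval_comp]
    congr 1
    rw [twistedExponent]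
    simp only [Polynomial.eval_add, Polynomial.eval_mul, Polynomial.eval_C, Polynomial.eval_X]
    by_cases hp : (p : ℂ) = 0
    · simp [hp]
    · field_simp
      ring

/-! ### The adjoint action in an associative algebra -/

/-- If `[a, z] = 0`, `[a, d] = u` and `[a, u] = 0`, then the adjoint series of `a` on `z^m d^s`
sums to `z^m (d + u)^s`. -/
theorem sum_iterated_commutator {R : Type*} [Ring R] [Algebra ℂ R] (a z d u : R)
    (hz : a * z - z * a = 0) (hd : a * d - d * a = u) (hu : a * u - u * a = 0) (m s : ℕ) :
    ∃ K₀ : ℕ, ∀ K, K₀ ≤ K → ∑ j ∈ Finset.range K,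
      ((j.factorial : ℂ)⁻¹) • (fun x => a * x - x * a)^[j] (z ^ m * d ^ s) =
        z ^ m * (d + u) ^ s := by
  open Polynomial in
  -- `D` stands for `e^{Xa} d e^{-Xa}`. The polynomial `G = z^m D^s` satisfies `[a, G] = G'`, so its
  -- coefficients are the iterated commutators divided by factorials.
  set D : R[X] := C d + X * C u with hD
  have hmul : ∀ P Q : R[X], C a * P - P * C a = derivative P →
      C a * Q - Q * C a = derivative Q → C a * (P * Q) - P * Q * C a = derivative (P * Q) := by
    intro P Q hP hQ
    rw [derivative_mul, ← hP, ← hQ]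
    noncomm_ring
  have hpow : ∀ (P : R[X]) (n : ℕ), C a * P - P * C a = derivative P →
      C a * P ^ n - P ^ n * C a = derivative (P ^ n) := by
    intro P n hP
    induction n with
    | zero => simp
    | succ n ih =>
      rw [pow_succ]
      exact hmul _ _ ih hP
  have hZ : C a * C z - C z * C a = derivative (C z) := by
    rw [derivative_C, ← C_mul, ← C_mul, ← C_sub, hz, C_0]
  have hDD : C a * D - D * C a = derivative D := by
    rw [hD, derivative_add, derivative_C, derivative_mul, derivative_X, derivative_C, mul_zero,
      add_zero, zero_add, one_mul, mul_add, add_mul, ← mul_assoc, ← X_mul_C, mul_assoc, mul_assoc,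
      add_sub_add_comm, ← mul_sub, ← C_mul, ← C_mul, ← C_mul, ← C_mul, ← C_sub, ← C_sub, hd, hu,
      C_0, mul_zero, add_zero]
  set G : R[X] := C z ^ m * D ^ s with hGdef
  have hG : C a * G - G * C a = derivative G := hmul _ _ (hpow _ m hZ) (hpow _ s hDD)
  have hcoeff : ∀ j, a * G.coeff j - G.coeff j * a = (j + 1 : ℂ) • G.coeff (j + 1) := by
    intro j
    have := congrArg (fun P : R[X] => P.coeff j) hG
    simp only [coeff_sub, coeff_C_mul, coeff_mul_C, coeff_derivative] at this
    rw [this, Algebra.smul_def, map_add, map_natCast, map_one]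
    exact ((Nat.cast_commute j _).add_left (Commute.one_left _)).eq.symm
  have hG0 : G.coeff 0 = z ^ m * d ^ s := by
    have h0 : ∀ P : R[X], ∀ n, (P ^ n).coeff 0 = P.coeff 0 ^ n := fun P n => by
      induction n with
      | zero => simp
      | succ n ih => rw [pow_succ, mul_coeff_zero, ih, pow_succ]
    rw [hGdef, mul_coeff_zero, h0, h0, hD, coeff_add, mul_coeff_zero, coeff_X_zero, zero_mul,
      add_zero, coeff_C_zero, coeff_C_zero]
  have hiter : ∀ j : ℕ, (fun x => a * x - x * a)^[j] (z ^ m * d ^ s) =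
      (j.factorial : ℂ) • G.coeff j := by
    intro j
    induction j with
    | zero => rw [Function.iterate_zero, id, hG0, Nat.factorial_zero, Nat.cast_one, one_smul]
    | succ j ih =>
      rw [Function.iterate_succ_apply', ih, mul_smul_comm, smul_mul_assoc, ← smul_sub, hcoeff, smul_smul, Nat.factorial_succ]
      congr 1
      push_cast
      ring
  -- Evaluation over a noncommutative ring is multiplicative here because `1` is central.
  have hev : G.eval 1 = z ^ m * (d + u) ^ s := by
    have hh : ∀ P : R[X], P.eval 1 = eval₂RingHom' (RingHom.id R) 1 (fun r => Commute.one_right r) P :=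
      fun P => rfl
    rw [hh, hGdef, map_mul, map_pow, map_pow, hD, map_add, map_mul, ← hh, ← hh, ← hh, ← hh, eval_C,
      eval_C, eval_C, eval_X, one_mul]
  refine ⟨G.natDegree + 1, fun K hK => ?_⟩
  rw [← hev, eval_eq_sum_range' (Nat.lt_of_succ_le hK)]
  refine Finset.sum_congr rfl fun j _ => ?_
  rw [hiter, smul_smul, inv_mul_cancel₀ (by exact_mod_cast j.factorial_ne_zero), one_smul, one_pow,
    mul_one]

/-! ### The one-body operators -/

theorem band_mul (c c' : ℤ → ℂ) (m m' : ℤ) :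
    band c m * band c' m' = band (fun k => c (k + m') * c' k) (m + m') := by
  refine LinearMap.ext fun f => funext fun i => ?_
  simp only [Module.End.mul_apply, band_apply]
  rw [show i - (m + m') = i - m - m' by ring, show i - m - m' + m' = i - m by ring]
  ring

theorem band_one_pow (p : ℤ) (m : ℕ) : band (fun _ => 1) p ^ m = band (fun _ => 1) (m * p) := by
  induction m with
  | zero =>
    refine LinearMap.ext fun f => funext fun i => ?_
    simp [band_apply]
  | succ m ih =>
    rw [pow_succ, ih, band_mul]
    congr 1
    · simp
    · push_cast
      ring

/-- `ζ ^ m ∂_ζ ^ s` as a one-body operator, where `∂_ζ` is the twisted derivation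
`λ^k ↦ ν_k λ^{k-p}`. -/
theorem band_twisted_pow {p : ℕ} (hp : 0 < p) (s : ℕ) :
    band (twistedExponent p) (-p) ^ s =
      band (fun k => (descPochhammer ℂ s).eval (twistedExponent p k)) (-(s * p)) := by
  have hp' : (p : ℂ) ≠ 0 := by exact_mod_cast hp.ne'
  induction s with
  | zero =>
    refine LinearMap.ext fun f => funext fun i => ?_
    simp [band_apply]
  | succ s ih =>
    rw [pow_succ', ih, band_mul]
    congr 1
    · funext k
      -- Each `∂_ζ` lowers the exponent by one, since `ν_{k-p} = ν_k - 1`; the next factor is `ν_k -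
      -- s`.
      rw [descPochhammer_succ_eval, twistedExponent_add hp, mul_comm]
      congr 1
      push_cast
      field_simp
      ring
    · push_cast
      ring

/-- The one-body operator of the generator of the evolution, `-(1/g) ∑ b_n λ^n`. -/
noncomputable def evolutionBand {N : ℕ} (g : ℂ) (b : Fin N → ℂ) : Module.End ℂ (ℤ → ℂ) :=
  ∑ i : Fin N, (b i / g) • (-band (fun _ => 1) ((i : ℤ) + 1))

/-- Multiplication by `(1/(gp)) ∑ n b_n λ^{n-p}`. -/
noncomputable def potentialBand {N : ℕ} (p : ℕ) (g : ℂ) (b : Fin N → ℂ) : Module.End ℂ (ℤ → ℂ) :=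
  ∑ i : Fin N, (((i : ℂ) + 1) * b i / (g * p)) • band (fun _ => 1) ((i : ℤ) + 1 - p)

theorem implements_evolutionGenerator {N : ℕ} (g : ℂ) (b : Fin N → ℂ) :
    Implements (evolutionGenerator g b) (evolutionBand g b) :=
  Implements.sum _ fun _ _ => (implements_bilinear _ _).smul _

theorem band_one_comm (m m' : ℤ) :
    band (fun _ => 1) m * band (fun _ => 1) m' = band (fun _ => 1) m' * band (fun _ => 1) m := by
  rw [band_mul, band_mul, add_comm]

theorem evolutionBand_comm {N : ℕ} (g : ℂ) (b : Fin N → ℂ) (m : ℤ) :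
    Commute (evolutionBand g b) (band (fun _ => 1) m) :=
  Commute.sum_left _ _ _ fun i _ =>
    (Commute.neg_left (show Commute _ _ from band_one_comm ((i : ℤ) + 1) m)).smul_left _

/-- This is `[∂_ζ, λ^n] = (n/p) λ^{n-p}`; the half-density shift in `ν_k` cancels in the difference.
-/
theorem evolutionBand_twisted {N p : ℕ} (hp : 0 < p) (g : ℂ) (b : Fin N → ℂ) :
    evolutionBand g b * band (twistedExponent p) (-p) -
      band (twistedExponent p) (-p) * evolutionBand g b = potentialBand p g b := by
  have hp' : (p : ℂ) ≠ 0 := by exact_mod_cast hp.ne'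
  rw [evolutionBand, Finset.sum_mul, Finset.mul_sum, ← Finset.sum_sub_distrib, potentialBand]
  refine Finset.sum_congr rfl fun i _ => ?_
  rw [smul_mul_assoc, mul_smul_comm]
  refine LinearMap.ext fun f => funext fun j => ?_
  simp only [LinearMap.smul_apply, LinearMap.sub_apply, LinearMap.neg_apply, Pi.smul_apply,
    Pi.sub_apply, Pi.neg_apply, Module.End.mul_apply, band_apply, smul_eq_mul]
  rw [show j - ((i : ℤ) + 1) - -(p : ℤ) = j - ((i : ℤ) + 1 - p) by ring,
    show j - -(p : ℤ) - ((i : ℤ) + 1) = j - ((i : ℤ) + 1 - p) by ring,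
    show j - -(p : ℤ) = j - ((i : ℤ) + 1 - p) + ((i : ℤ) + 1) by ring, twistedExponent_add hp]
  push_cast
  by_cases hg : g = 0
  · simp [hg]
  · field_simp
    ring

theorem evolutionBand_potential {N p : ℕ} (g : ℂ) (b : Fin N → ℂ) :
    Commute (evolutionBand g b) (potentialBand p g b) :=
  Commute.sum_right _ _ _ fun _ _ => (evolutionBand_comm g b _).smul_right _

/-! ### Invariance of the point of the Grassmannian -/

theorem map_span_range_le {Φ : ℕ → ℤ → ℂ} {T : Module.End ℂ (ℤ → ℂ)}
    (h : ∀ k, T (Φ k) ∈ Submodule.span ℂ (Set.range Φ)) :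
    ∀ f ∈ Submodule.span ℂ (Set.range Φ), T f ∈ Submodule.span ℂ (Set.range Φ) := by
  intro f hf
  have : Submodule.span ℂ (Set.range Φ) ≤ (Submodule.span ℂ (Set.range Φ)).comap T := by
    rw [Submodule.span_le]
    rintro _ ⟨k, rfl⟩
    exact h k
  exact this hf

section Invariance

variable {N p : ℕ} {hN : 0 < N} {g : ℂ} {b : Fin N → ℂ} {W Winv : PDO (Fun N)}

theorem SolvesDouglas.band_mem {γ : ℂ} (hW : SolvesDouglas hN p g γ b W Winv) :
    ∀ f ∈ Submodule.span ℂ (Set.range (satoFrame hN g W)),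
      band (fun _ => 1) p f ∈ Submodule.span ℂ (Set.range (satoFrame hN g W)) := by
  refine map_span_range_le fun k => ?_
  have h := frame_mul_mem_span hN g hW.inv_mul hW.P_differential k
  simp only [PDO.mul_dpow_coeff] at h
  convert h using 1
  funext m
  rw [band_apply, one_mul]
  rfl

/-- Divide the action of the string operator on symbols by `gp`. With the given `γ`, `(γ + k)/p` is
exactly `ν_k`, so its derivative part becomes the twisted `∂_ζ`. -/
theorem SolvesDouglas.connection_mem (hp : 0 < p) (hg : g ≠ 0)
    (hW : SolvesDouglas hN p g (-((p : ℂ) - 1) / 2) b W Winv) :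
    ∀ f ∈ Submodule.span ℂ (Set.range (satoFrame hN g W)),
      (band (twistedExponent p) (-p) + potentialBand p g b) f ∈
        Submodule.span ℂ (Set.range (satoFrame hN g W)) := by
  have hp' : (p : ℂ) ≠ 0 := by exact_mod_cast hp.ne'
  refine map_span_range_le fun k => ?_
  have h := Submodule.smul_mem _ (1 / (g * p))
    (frame_mul_mem_span hN g hW.inv_mul hW.Q_differential k)
  convert h using 1
  funext m
  rw [Pi.smul_apply, mul_stringOp_symbol, potentialBand, LinearMap.add_apply, Pi.add_apply,
    LinearMap.sum_apply, Finset.sum_apply, band_apply, sub_neg_eq_add, smul_eq_mul, mul_add,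
    Finset.mul_sum, add_comm]
  congr 1
  · refine Finset.sum_congr rfl fun i _ => ?_
    rw [LinearMap.smul_apply, Pi.smul_apply, band_apply, smul_eq_mul, one_mul, satoFrame]
    ring
  · rw [satoFrame, twistedExponent]
    push_cast
    field_simp
    ring

end Invariance

/-! ### The constraints -/

/-- By the Jacobi identity `ad a` and `ad x` commute when `a` and `x` do. -/
theorem iteratedAd_commutator {a x : Module.End ℂ Fock} (h : a * x = x * a)
    (y : Module.End ℂ Fock) (j : ℕ) :
    iteratedAd a (x * y - y * x) j = x * iteratedAd a y j - iteratedAd a y j * x := by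
  have key : ∀ z, commutatorMap a (commutatorMap x z) = commutatorMap x (commutatorMap a z) := by
    intro z
    simp only [commutatorMap_apply]
    have e1 : a * (x * z) = x * (a * z) := by rw [← mul_assoc, h, mul_assoc]
    have e2 : z * x * a = z * a * x := by rw [mul_assoc, ← h, mul_assoc]
    rw [mul_sub, sub_mul, mul_sub, sub_mul, e1, e2, mul_assoc a z x, mul_assoc x z a]
    abel
  exact (Function.Commute.iterate_left (f := commutatorMap a) (g := commutatorMap x) key j).eq y

theorem iterate_commutator_neg {R : Type*} [Ring R] (a x : R) (j : ℕ) :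
    (fun X => a * X - X * a)^[j] (-x) = -(fun X => a * X - X * a)^[j] x :=
  iterate_map_neg (AddMonoidHom.mulLeft a - AddMonoidHom.mulRight a) j x

/-- Every generator is a commutator of a current mode with a generator of higher spin. -/
theorem Wgen_eq_commutator {p : ℕ} (hp : 0 < p) (t : ℕ) (n : ℤ) :
    Wgen p (t + 1) n = alpha p *
        bilinear (fun k => (descPochhammer ℂ (t + 1)).eval (twistedExponent p k)) ((n - 1) * p) -
      bilinear (fun k => (descPochhammer ℂ (t + 1)).eval (twistedExponent p k)) ((n - 1) * p) *
        alpha p := by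
  have hp' : (p : ℂ) ≠ 0 := by exact_mod_cast hp.ne'
  have hp'' : (p : ℤ) ≠ 0 := by exact_mod_cast hp.ne'
  have hm : (n - 1) * (p : ℤ) + p = n * p := by ring
  have hn : n * (p : ℤ) = 0 ↔ n = 0 := mul_eq_zero_iff_right hp''
  -- Shifting `k` by `p` shifts `ν_k` by one, and the difference of a falling factorial is a falling
  -- factorial of one degree less. The factor `t + 1` is the prefactor `s` of the generator.
  have hdiff : (fun k : ℤ => (descPochhammer ℂ (t + 1)).eval (twistedExponent p (k + p)) -
      (descPochhammer ℂ (t + 1)).eval (twistedExponent p k)) =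
      fun k => ((t + 1 : ℕ) : ℂ) * (descPochhammer ℂ t).eval (twistedExponent p k) := by
    funext k
    rw [twistedExponent_add hp, Int.cast_natCast, div_self hp']
    have h1 := descPochhammer_succ_eval t (twistedExponent p k)
    have h2 : (descPochhammer ℂ (t + 1)).eval (twistedExponent p k + 1) =
        (twistedExponent p k + 1) * (descPochhammer ℂ t).eval (twistedExponent p k) := by
      rw [descPochhammer_succ_left]
      simp
    rw [h1, h2]
    push_cast
    ring
  -- The central term, a sum over `0 ≤ k < p`, is exactly the zero-point constant.
  rw [alpha_bilinear hp, hdiff, bilinear_smul, hm, Wgen, Nat.add_sub_cancel, zeroPoint_eq_sum hp]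
  simp only [hn]

theorem evolutionGenerator_commute_alpha {N p : ℕ} (hp : 0 < p) (g : ℂ) (b : Fin N → ℂ) :
    evolutionGenerator g b * alpha p = alpha p * evolutionGenerator g b := by
  rw [evolutionGenerator, Finset.sum_mul, Finset.mul_sum]
  refine Finset.sum_congr rfl fun i _ => ?_
  rw [smul_mul_assoc, mul_smul_comm]
  congr 1
  have h := alpha_bilinear hp (fun _ => 1) ((i : ℤ) + 1)
  rw [if_neg (by omega), zero_smul, add_zero] at h
  simp only [sub_self, bilinear_zero] at h
  exact (sub_eq_zero.1 h).symm

theorem theorem2 (p q : ℕ) (hp : 0 < p) (hN : 0 < p + q) (g : ℂ) (hg : g ≠ 0)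
    (b : Fin (p + q) → ℂ) (W Winv : PDO (Fun (p + q)))
    (hW : SolvesDouglas hN p g (-((p : ℂ) - 1) / 2) b W Winv) :
    ∀ (s : ℕ) (n : ℤ), 1 ≤ s → -(s : ℤ) + 1 ≤ n →
      (initialState hN g b W).AnnihilatedBy (Wgen p s n) := by
  intro s n hs hn
  obtain ⟨t, rfl⟩ := Nat.exists_eq_add_of_le' hs
  set A := evolutionGenerator g b with hA
  set c : ℤ → ℂ := fun k => (descPochhammer ℂ (t + 1)).eval (twistedExponent p k) with hc
  set B := bilinear c ((n - 1) * p) with hB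
  have hΦ := isFrame_satoFrame hN g hW.sato_form
  have hiter : ∀ j, iteratedAd A (Wgen p (t + 1) n) j =
      alpha p * iteratedAd A B j - iteratedAd A B j * alpha p := by
    intro j
    rw [Wgen_eq_commutator hp]
    exact iteratedAd_commutator (evolutionGenerator_commute_alpha hp g b) B j
  -- `B` acts through `ζ^m ∂_ζ^{t+1}` with `m = n + t`, and the bound on `n` says precisely that `m
  -- ≥ 0`.
  obtain ⟨m, hm⟩ := Int.eq_ofNat_of_zero_le (show 0 ≤ n + t by push_cast at hn; omega)
  have hband : band c ((n - 1) * p) =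
      band (fun _ => 1) p ^ m * band (twistedExponent p) (-p) ^ (t + 1) := by
    rw [band_one_pow, band_twisted_pow hp, band_mul]
    simp only [one_mul]
    congr 1
    rw [← hm]
    push_cast
    ring
  obtain ⟨K₀, hK₀⟩ := sum_iterated_commutator (evolutionBand g b) (band (fun _ => 1) p)
    (band (twistedExponent p) (-p)) (potentialBand p g b)
    (sub_eq_zero.2 (evolutionBand_comm g b p)) (evolutionBand_twisted hp g b)
    (sub_eq_zero.2 (evolutionBand_potential g b)) m (t + 1)
  -- The coefficients of `B` have degree at most `t + 1`, so `B` lies in `polynomialOps (t + 2)` and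
  -- dies after `t + 3` commutators. `K₀` is where the one-body series has reached its sum.
  refine ⟨max K₀ (t + 3), fun j hj => ?_, ?_⟩
  · show iteratedAd A (Wgen p (t + 1) n) j = 0
    rw [hiter, iteratedAd_eq_zero g b (bilinear_descPochhammer_mem p (t + 1) _)
      ((le_max_right _ _).trans hj), mul_zero, zero_mul, sub_self]
  · set K := max K₀ (t + 3)
    set Y := ∑ j ∈ Finset.range K, ((j.factorial : ℂ)⁻¹) • iteratedAd A B j with hY
    have hsum : (∑ j ∈ Finset.range K, ((j.factorial : ℂ)⁻¹) •
        iteratedAd A (Wgen p (t + 1) n) j) = alpha p * Y - Y * alpha p := by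
      simp only [hiter, hY, Finset.mul_sum, Finset.sum_mul, mul_smul_comm, smul_mul_assoc,
        smul_sub, Finset.sum_sub_distrib]
    -- `Y` is the conjugate of `B` by `e^A`. Its one-body operator is found by summing the adjoint
    -- series on the one-body side, where it is explicit.
    have hYT : Implements Y (-(band (fun _ => 1) p ^ m *
        (band (twistedExponent p) (-p) + potentialBand p g b) ^ (t + 1))) := by
      rw [← hK₀ K (le_max_left _ _), ← hband, hY, ← Finset.sum_neg_distrib]
      refine Implements.sum _ fun j _ => ?_
      rw [← smul_neg, ← iterate_commutator_neg]
      exact ((implements_evolutionGenerator g b).iteratedAd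
        (implements_bilinear c ((n - 1) * p)) j).smul _
    have hA0 : A ∈ chargeZeroOps := Subalgebra.sum_mem _ fun i _ =>
      Subalgebra.smul_mem _ (bilinear_mem_chargeZeroOps _ _) _
    have hY0 : Y ∈ chargeZeroOps := Subalgebra.sum_mem _ fun j _ =>
      Subalgebra.smul_mem _ (iteratedAd_mem_chargeZeroOps hA0 (bilinear_mem_chargeZeroOps _ _) j) _
    have hpow : ∀ {T : Module.End ℂ (ℤ → ℂ)} (k : ℕ),
        (∀ f ∈ Submodule.span ℂ (Set.range (satoFrame hN g W)),
          T f ∈ Submodule.span ℂ (Set.range (satoFrame hN g W))) →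
        ∀ f ∈ Submodule.span ℂ (Set.range (satoFrame hN g W)),
          (T ^ k) f ∈ Submodule.span ℂ (Set.range (satoFrame hN g W)) := by
      intro T k hT
      induction k with
      | zero => exact fun f hf => hf
      | succ k ih =>
        intro f hf
        rw [pow_succ', Module.End.mul_apply]
        exact hT _ (ih f hf)
    obtain ⟨y, hy⟩ := hΦ.state_eigenvector hYT hY0 fun f hf =>
      Submodule.neg_mem _ (hpow m hW.band_mem _ (hpow (t + 1) (hW.connection_mem hp hg) f hf))
    obtain ⟨e, he⟩ := hΦ.state_eigenvector (implements_bilinear (fun _ => 1) p)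
      (bilinear_mem_chargeZeroOps _ _) fun f hf => Submodule.neg_mem _ (hW.band_mem f hf)
    change alpha p _ = _ at he
    show (∑ j ∈ Finset.range K, ((j.factorial : ℂ)⁻¹) • iteratedAd A (Wgen p (t + 1) n) j)
      (decomposableState (satoFrame hN g W)) = 0
    -- The values of the eigenvalues `y` and `e` play no role: scalars commute, so the commutator
    -- vanishes on the common eigenvector.
    rw [hsum, LinearMap.sub_apply, Module.End.mul_apply, Module.End.mul_apply, hy, he, map_smul,
      map_smul, hy, he, smul_comm, sub_self]
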